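/- **Theorem (MPNN generalization theorem).** Fix $r>0$ and $L,d\in\mathbb N$. *Optimal transport.* For a measurable space $X$ with a distance function $c$ and measures $\mu,\nu$ of total mass at most one, let $\mathbf{OT}_c(\mu,\nu)=\inf_\gamma\int c\,d\gamma+\big|\|\mu\|-\|\nu\|\big|$, where $\|\mu\|$ is the total mass and, if $\|\mu\|\le\|\nu\|$, $\gamma$ ranges over the measures on $X\times X$ with first marginal equal to $\mu$ and second marginal $\le\nu$ (symmetrically if $\|\nu\|\le\|\mu\|$). *Iterated degree measures.* Let $\mathcal M^0=\mathbb B^d_r=\{x\in\mathbb R^d:\|x\|_2\le r\}$, $\mathcal H^j=\prod_{i\le j}\mathcal M^i$ with the product topology, and $\mathcal M^{j+1}=\mathscr M_{\le1}(\mathcal H^j)$, the Borel measures of total mass at most one, with the weak$^*$ topology. Let $d^0_{\rm IDM}(x,y)=\|x-y\|_2$ and $d^{j}_{\rm IDM}(\mu,\nu)=\|\mu_0-\nu_0\|_2+\sum_{i=1}^{j}\mathbf{OT}_{d^{i-1}_{\rm IDM}}(\mu_i,\nu_i)$ on $\mathcal H^j$. *Graphon-signals.* $\mathcal{WL}^d_r$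 is the set of pairs $(W,f)$ with $W:[0,1]^2\to[0,1]$ measurable and symmetric and $f:[0,1]\to\mathbb B^d_r$ measurable. Put $\gamma_0=f$, and let $\gamma_{j+1}(x)\in\mathcal H^{j+1}$ be $\gamma_j(x)$ followed by the measure $A\mapsto\int_{\gamma_j^{-1}(A)}W(x,y)\,dy$. Let $\Gamma_{(W,f),L}$ be the push-forward of Lebesgue measure under $\gamma_L$, and $\delta^L_{\rm DIDM}((W,f),(V,g))=\mathbf{OT}_{d^L_{\rm IDM}}(\Gamma_{(W,f),L},\Gamma_{(V,g),L})$. *Input space.* Let $(\mathcal X,\rho)$ be either the set $\mathscr P(\mathcal H^L)$ of Borel probability measures on $\mathcal H^L$ with $\rho=\mathbf{OT}_{d^L_{\rm IDM}}$, or $\mathcal{WL}^d_r$ with $\rho=\delta^L_{\rm DIDM}$. For $C',B'>0$ and $m\in\mathbb N$ let $\mathrm{Lip}(\mathcal X,C',B')$ be the set of all $M:\mathcal X\to\mathbb R^m$ with $\|M(x)-M(x')\|_2\le C'\rho(x,x')$ and $\|M(x)\|_2\le B'$ for all $x,x'$. *MPNNs.* An $L$-layer MPNN model with readout consists of Lipschitz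 maps $\varphi^{(0)}:\mathbb R^d\to\mathbb R^{d_0}$, $\varphi^{(t)}:\mathbb R^{2d_{t-1}}\to\mathbb R^{d_t}$ ($1\le t\le L$), $\psi:\mathbb R^{d_L}\to\mathbb R^m$. On $\mathscr P(\mathcal H^L)$ it is the function $\nu\mapsto\psi\big(\int\mathfrak h^{(L)}d\nu\big)$, where $\mathfrak h^{(0)}=\varphi^{(0)}$ and $\mathfrak h^{(t)}(\alpha)=\varphi^{(t)}\big(\mathfrak h^{(t-1)}(\alpha_0,\dots,\alpha_{t-1}),\int\mathfrak h^{(t-1)}d\alpha_t\big)$. On $\mathcal{WL}^d_r$ it is $(W,f)\mapsto\psi\big(\int_0^1\mathfrak f^{(L)}_x dx\big)$, where $\mathfrak f^{(0)}=\varphi^{(0)}\circ f$ and $\mathfrak f^{(t)}_x=\varphi^{(t)}\big(\mathfrak f^{(t-1)}_x,\int_0^1W(x,y)\mathfrak f^{(t-1)}_y dy\big)$. **(1)** For all $A_1,A_2>0$ there are $C_\Theta,B_\Theta>0$, depending only on $r,L,A_1,A_2$, such that every $L$-layer MPNN model with readout whose maps $\varphi^{(0)},\dots,\varphi^{(L)},\psi$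 all have Lipschitz constant at most $A_1$ and norm of the value at $0$ at most $A_2$ belongs, as a function on $\mathcal X$, to $\mathrm{Lip}(\mathcal X,C_\Theta,B_\Theta)$ (for both choices of $\mathcal X$, all $d$, $m$ and all hidden dimensions). **(2)** Let $K\ge1$ and equip $\mathcal X\times\{0,1\}^K$ with the distance $\rho(x,x')+\|y-y'\|_2$ and the Borel $\sigma$-algebra of the topology generated by its open balls. For every $\epsilon>0$ this space is covered by finitely many open balls of radius $\epsilon$; let $\kappa(\epsilon)$ be the least number of such balls, $\xi(\epsilon)=\kappa(\epsilon)^2\log(\kappa(\epsilon))/\epsilon^2$, and $\xi^{-1}(t)=\inf\{\epsilon>0:\xi(\epsilon)\le t\}$ (this is the inverse function of $\xi$ wherever $t>0$ is a value of $\xi$). Let $\mathcal E:\mathbb R^m\times\{0,1\}^K\to\mathbb R$ be a loss with $|\mathcal E(v,y)-\mathcal E(v',y')|\le C_{\mathcal E}(\|v-v'\|_2+\|y-y'\|_2)$. Let $C_\Theta,B_\Theta>0$, $C=C_{\mathcal E}\max(C_\Theta,1)$ and $B=C_{\mathcal E}(B_\Theta+1)+|\mathcal E(0,0)|$. Let $\tau$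 be a probability measure on $\mathcal X\times\{0,1\}^K$, let $N\ge1$ and $p>0$. Then there is an event $\mathcal U^p\subset(\mathcal X\times\{0,1\}^K)^N$ with $\tau^N(\mathcal U^p)\ge1-p$ such that for every $\mathbf X=((\nu_i,Y_i))_{i=1}^N\in\mathcal U^p$ and every $M\in\mathrm{Lip}(\mathcal X,C_\Theta,B_\Theta)$ (which may depend on $\mathbf X$), $$\Big|\int\mathcal E(M(\nu),y)\,d\tau(\nu,y)-\frac1N\sum_{i=1}^N\mathcal E(M(\nu_i),Y_i)\Big|\le\xi^{-1}(N)\Big(2C+\tfrac1{\sqrt2}B\big(1+\sqrt{\log(2/p)}\big)\Big).$$ -/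

import Mathlib

open MeasureTheory Filter Topology
open scoped ENNReal NNReal unitInterval

noncomputable section

namespace MPNNGen

/-- `ℝⁿ` with the Euclidean norm. -/
abbrev Vec (n : ℕ) : Type := EuclideanSpace ℝ (Fin n)

/-! ### Unbalanced optimal transport -/

/-- `γ` is a coupling of `μ` and `ν`: its marginal on the side of the smaller total mass is that
measure itself, its marginal on the other side is dominated by the other measure. -/
def IsCoupling {X : Type*} [MeasurableSpace X] (μ ν : Measure X) (γ : Measure (X × X)) : Prop :=
  (μ Set.univ ≤ ν Set.univ → γ.map Prod.fst = μ ∧ γ.map Prod.snd ≤ ν) ∧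
  (ν Set.univ ≤ μ Set.univ → γ.map Prod.fst ≤ μ ∧ γ.map Prod.snd = ν)

/-- Unbalanced optimal transport distance with ground distance `c`, as an extended nonnegative
number (so that no convention about integrability or empty infima is involved). -/
def OT {X : Type*} [MeasurableSpace X] (c : X → X → ℝ≥0∞) (μ ν : Measure X) : ℝ≥0∞ :=
  (⨅ (γ : Measure (X × X)) (_ : IsCoupling μ ν γ), ∫⁻ z, c z.1 z.2 ∂γ) +
    ENNReal.ofReal |μ.real Set.univ - ν.real Set.univ|

/-! ### Iterated degree measures -/

/-- Borel measures of total mass at most one, with the weak-* topology (the subspace topology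
from `FiniteMeasure`). -/
abbrev SubProb (X : Type) [MeasurableSpace X] : Type := {μ : FiniteMeasure X // μ.mass ≤ 1}

/-- A topological space with its Borel sigma-algebra. -/
structure BorelTop where
  carrier : Type
  top : TopologicalSpace carrier
  meas : MeasurableSpace carrier
  isBorel : BorelSpace carrier

attribute [instance] BorelTop.top BorelTop.meas BorelTop.isBorel

/-- From `ℋ^L` to `ℋ^(L+1) = ℋ^L × ℳ_{≤1}(ℋ^L)`, with the product topology and its Borel
sigma-algebra. -/
def BorelTop.next (H : BorelTop) : BorelTop where
  carrier := H.carrier × SubProb H.carrier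
  top := inferInstance
  meas := borel (H.carrier × SubProb H.carrier)
  isBorel := @BorelSpace.mk _ _ (borel (H.carrier × SubProb H.carrier)) rfl

/-- `ℋ^L` as a topological and measurable space: `ℋ^0` is the closed ball of radius `r` in `ℝ^d`,
and `ℋ^L = ℳ^0 × ⋯ × ℳ^L` where `ℳ^(j+1) = ℳ_{≤1}(ℋ^j)`. -/
def idmSpace (d : ℕ) (r : ℝ) : ℕ → BorelTop
  | 0 => ⟨Metric.closedBall (0 : Vec d) r, inferInstance, inferInstance, inferInstance⟩
  | L + 1 => (idmSpace d r L).next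

/-- The space `ℋ^L` of iterated degree measures of order `L`. -/
abbrev IDM (d : ℕ) (r : ℝ) (L : ℕ) : Type := (idmSpace d r L).carrier

namespace IDM

variable {d : ℕ} {r : ℝ} {L : ℕ}

/-- An order-`0` IDM as a vector. -/
def toVec (α : IDM d r 0) : Vec d := Subtype.val (p := fun x => x ∈ Metric.closedBall (0 : Vec d) r) α

/-- A point of the ball as an order-`0` IDM. -/
def ofBall (x : Metric.closedBall (0 : Vec d) r) : IDM d r 0 := x

/-- The projection `ℋ^(L+1) → ℋ^L`. -/
def init (α : IDM d r (L + 1)) : IDM d r L :=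
  Prod.fst (α := IDM d r L) (β := SubProb (IDM d r L)) α

/-- The projection `ℋ^(L+1) → ℳ^(L+1)` to the last entry. -/
def last (α : IDM d r (L + 1)) : SubProb (IDM d r L) :=
  Prod.snd (α := IDM d r L) (β := SubProb (IDM d r L)) α

/-- Append an entry of `ℳ^(L+1)` to an element of `ℋ^L`. -/
def snoc (α : IDM d r L) (μ : SubProb (IDM d r L)) : IDM d r (L + 1) := (α, μ)

/-- The last entry, as a measure on `ℋ^L`. -/
def lastMeasure (α : IDM d r (L + 1)) : Measure (IDM d r L) := α.last.1

end IDM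

/-- The IDM distance of order `L`: the Euclidean distance of the entries of index `0` plus the sum
over `1 ≤ j ≤ L` of the optimal transport distances, with ground distance of order `j - 1`, of the
entries of index `j`. -/
def dIDM (d : ℕ) (r : ℝ) : (L : ℕ) → IDM d r L → IDM d r L → ℝ≥0∞
  | 0 => fun α β => edist α.toVec β.toVec
  | L + 1 => fun α β =>
      dIDM d r L α.init β.init + OT (dIDM d r L) α.lastMeasure β.lastMeasure

/-! ### Graphon-signals -/

/-- A graphon with a signal taking values in the closed ball of radius `r` of `ℝ^d`. -/
structure GraphonSignal (d : ℕ) (r : ℝ) where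
  W : I → I → ℝ
  measurable_W : Measurable (Function.uncurry W)
  symm_W : ∀ x y, W x y = W y x
  nonneg_W : ∀ x y, 0 ≤ W x y
  le_one_W : ∀ x y, W x y ≤ 1
  f : I → Metric.closedBall (0 : Vec d) r
  measurable_f : Measurable f

namespace GraphonSignal

variable {d : ℕ} {r : ℝ}

/-- The measure `A ↦ ∫_A W(x, y) dy` on `[0,1]`. -/
def edgeMeasure (G : GraphonSignal d r) (x : I) : Measure I :=
  volume.withDensity fun y => ENNReal.ofReal (G.W x y)

theorem map_edgeMeasure_univ_le (G : GraphonSignal d r) (x : I) {X : Type} [MeasurableSpace X]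
    (g : I → X) : (G.edgeMeasure x).map g Set.univ ≤ 1 := by
  have h1 : G.edgeMeasure x Set.univ ≤ 1 := by
    rw [edgeMeasure, withDensity_apply _ MeasurableSet.univ, Measure.restrict_univ]
    calc ∫⁻ y, ENNReal.ofReal (G.W x y) ≤ ∫⁻ _ : I, 1 :=
          lintegral_mono fun y => by
            simpa using ENNReal.ofReal_le_ofReal (G.le_one_W x y)
      _ = 1 := by simp
  by_cases hg : AEMeasurable g (G.edgeMeasure x)
  · rw [Measure.map_apply_of_aemeasurable hg MeasurableSet.univ]
    simpa using h1
  · rw [Measure.map_of_not_aemeasurable hg]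
    simp

/-- The measure `A ↦ ∫_{g⁻¹(A)} W(x, y) dy`, which has total mass at most one. -/
def pushEdge (G : GraphonSignal d r) {X : Type} [MeasurableSpace X] (g : I → X) (x : I) :
    SubProb X :=
  ⟨⟨(G.edgeMeasure x).map g, ⟨(G.map_edgeMeasure_univ_le x g).trans_lt ENNReal.one_lt_top⟩⟩, by
    have h : ((G.edgeMeasure x).map g Set.univ).toNNReal ≤ (1 : ℝ≥0∞).toNNReal :=
      ENNReal.toNNReal_mono ENNReal.one_ne_top (G.map_edgeMeasure_univ_le x g)
    rw [ENNReal.toNNReal_one] at h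
    exact h⟩

/-- The computation IDM of order `L` of a graphon-signal. -/
def compIDM (G : GraphonSignal d r) : (L : ℕ) → I → IDM d r L
  | 0 => fun x => IDM.ofBall (G.f x)
  | L + 1 => fun x => IDM.snoc (G.compIDM L x) (G.pushEdge (G.compIDM L) x)

/-- The computation DIDM of order `L`: the push-forward of Lebesgue measure on `[0,1]` by the
computation IDM. -/
def compDIDM (G : GraphonSignal d r) (L : ℕ) : Measure (IDM d r L) :=
  (volume : Measure I).map (G.compIDM L)

end GraphonSignal

/-- The DIDM mover's distance between graphon-signals. -/
def deltaDIDM (d : ℕ) (r : ℝ) (L : ℕ) (G G' : GraphonSignal d r) : ℝ≥0∞ :=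
  OT (dIDM d r L) (G.compDIDM L) (G'.compDIDM L)

/-! ### The two input spaces -/

/-- The two kinds of inputs: DIDMs and graphon-signals. -/
inductive InputKind
  | didm
  | graphonSignal

/-- The input space `𝒳`: Borel probability measures on `ℋ^L`, or graphon-signals. -/
def Input (d : ℕ) (r : ℝ) (L : ℕ) : InputKind → Type
  | .didm => ProbabilityMeasure (IDM d r L)
  | .graphonSignal => GraphonSignal d r

/-- The distance of the input space `𝒳`: optimal transport with the IDM distance as ground
distance, or the DIDM mover's distance. -/
def inputDist (d : ℕ) (r : ℝ) (L : ℕ) : (k : InputKind) → Input d r L k → Input d r L k → ℝ≥0∞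
  | .didm => fun (μ ν : ProbabilityMeasure (IDM d r L)) =>
      OT (dIDM d r L) (μ : Measure (IDM d r L)) (ν : Measure (IDM d r L))
  | .graphonSignal => fun (G G' : GraphonSignal d r) => deltaDIDM d r L G G'

/-! ### Message passing neural networks -/

/-- An `L`-layer MPNN model with readout, of input dimension `d` and output dimension `m`.
`update t` is the update function of layer `t + 1`, on pairs of vectors with the Euclidean norm of
the concatenation; only `update t` with `t < L` belong to the model. -/
structure MPNN (d L m : ℕ) where
  dim : ℕ → ℕ
  initial : Vec d → Vec (dim 0)
  update : (t : ℕ) → WithLp 2 (Vec (dim t) × Vec (dim t)) → Vec (dim (t + 1))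
  readout : Vec (dim L) → Vec m
  lipschitz_initial : ∃ c, LipschitzWith c initial
  lipschitz_update : ∀ t < L, ∃ c, LipschitzWith c (update t)
  lipschitz_readout : ∃ c, LipschitzWith c readout

namespace MPNN

variable {d L m : ℕ}

/-- Hidden representations of IDMs. -/
def idmFeature (Φ : MPNN d L m) (r : ℝ) : (t : ℕ) → IDM d r t → Vec (Φ.dim t)
  | 0 => fun α => Φ.initial α.toVec
  | t + 1 => fun α => Φ.update t (WithLp.toLp 2
      (Φ.idmFeature r t α.init, ∫ β, Φ.idmFeature r t β ∂α.lastMeasure))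

/-- Hidden representations of the nodes of a graphon-signal. -/
def nodeFeature (Φ : MPNN d L m) {r : ℝ} (G : GraphonSignal d r) : (t : ℕ) → I → Vec (Φ.dim t)
  | 0 => fun x => Φ.initial (G.f x : Vec d)
  | t + 1 => fun x => Φ.update t (WithLp.toLp 2
      (Φ.nodeFeature G t x, ∫ y, G.W x y • Φ.nodeFeature G t y))

/-- The output of the model with readout on DIDMs and on graphon-signals. -/
def output (Φ : MPNN d L m) (r : ℝ) : (k : InputKind) → Input d r L k → Vec m
  | .didm => fun (ν : ProbabilityMeasure (IDM d r L)) =>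
      Φ.readout (∫ α, Φ.idmFeature r L α ∂(ν : Measure (IDM d r L)))
  | .graphonSignal => fun (G : GraphonSignal d r) =>
      Φ.readout (∫ x, Φ.nodeFeature G L x)

/-- The class `Θ`: all Lipschitz constants are at most `A₁`, all formal biases at most `A₂`. -/
def MemTheta (Φ : MPNN d L m) (A₁ A₂ : ℝ) : Prop :=
  (LipschitzWith A₁.toNNReal Φ.initial ∧ ‖Φ.initial 0‖ ≤ A₂) ∧
  (∀ t < L, LipschitzWith A₁.toNNReal (Φ.update t) ∧ ‖Φ.update t 0‖ ≤ A₂) ∧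
  (LipschitzWith A₁.toNNReal Φ.readout ∧ ‖Φ.readout 0‖ ≤ A₂)

end MPNN

/-! ### Hypothesis class, covering numbers, risks -/

/-- The class `Lip(𝒳, C, B)` of functions `X → ℝᵐ` with Lipschitz constant at most `C` with respect
to `dist` and with norm bounded by `B`. -/
def LipClass {X : Type*} (dist : X → X → ℝ≥0∞) (m : ℕ) (C B : ℝ) : Set (X → Vec m) :=
  {M | (∀ x x', edist (M x) (M x') ≤ ENNReal.ofReal C * dist x x') ∧ ∀ x, ‖M x‖ ≤ B}

/-- The label space `{0,1}^K` as a subspace of Euclidean `ℝ^K`. -/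
def Label (K : ℕ) : Type := {y : Vec K // ∀ k, y k = 0 ∨ y k = 1}

/-- The label as a vector of `ℝ^K`. -/
def Label.vec {K : ℕ} (y : Label K) : Vec K := y.1

/-- The label `0`. -/
def Label.zero (K : ℕ) : Label K := ⟨0, fun _ => Or.inl rfl⟩

/-- The space `𝒳 × {0,1}^K` of labelled data. -/
structure Sample (d : ℕ) (r : ℝ) (L : ℕ) (k : InputKind) (K : ℕ) where
  input : Input d r L k
  label : Label K

/-- The product (sum) distance on `𝒳 × {0,1}^K`. -/
def sampleDist (d : ℕ) (r : ℝ) (L : ℕ) (k : InputKind) (K : ℕ) (a b : Sample d r L k K) : ℝ≥0∞ :=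
  inputDist d r L k a.input b.input + edist a.label.vec b.label.vec

/-- The topology generated by the open balls of a distance function (no triangle inequality is
presupposed). -/
abbrev ballTopology {X : Type*} (dist : X → X → ℝ≥0∞) : TopologicalSpace X :=
  TopologicalSpace.generateFrom {s | ∃ (c : X) (ε : ℝ), s = {x | dist c x < ENNReal.ofReal ε}}

/-- `𝒳 × {0,1}^K` carries the Borel sigma-algebra of its distance. -/
instance (d : ℕ) (r : ℝ) (L : ℕ) (k : InputKind) (K : ℕ) : MeasurableSpace (Sample d r L k K) :=
  @borel _ (ballTopology (sampleDist d r L k K))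

/-- The space is covered by `n` open balls of radius `ε`. -/
def CoveredBy {X : Type*} (dist : X → X → ℝ≥0∞) (ε : ℝ) (n : ℕ) : Prop :=
  ∃ c : Fin n → X, ∀ x, ∃ i, dist (c i) x < ENNReal.ofReal ε

/-- The covering number `κ(ε)`: the least number of open balls of radius `ε` covering the space
(meaningful when a finite cover exists). -/
def coveringNumber {X : Type*} (dist : X → X → ℝ≥0∞) (ε : ℝ) : ℕ :=
  sInf {n | CoveredBy dist ε n}

/-- `ξ(ε) = κ(ε)² log κ(ε) / ε²`. -/
def xi {X : Type*} (dist : X → X → ℝ≥0∞) (ε : ℝ) : ℝ :=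
  (coveringNumber dist ε : ℝ) ^ 2 * Real.log (coveringNumber dist ε) / ε ^ 2

/-- The inverse of the nonincreasing function `ξ` on `(0, ∞)`; since `κ` is a step function, `ξ` has
jumps, and the inverse is `inf {ε > 0 : ξ(ε) ≤ t}`, which is the solution of `ξ(ε) = t` whenever
`t > 0` and there is one. -/
def xiInv {X : Type*} (dist : X → X → ℝ≥0∞) (t : ℝ) : ℝ :=
  sInf {ε : ℝ | 0 < ε ∧ xi dist ε ≤ t}

/-- `loss` is Lipschitz with constant `c` on `ℝᵐ × {0,1}^K`. -/
def LossLipschitz {m K : ℕ} (c : ℝ) (loss : Vec m → Label K → ℝ) : Prop :=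
  ∀ v v' y y', |loss v y - loss v' y'| ≤ c * (‖v - v'‖ + ‖y.vec - y'.vec‖)

/-- The statistical risk. -/
def risk {d : ℕ} {r : ℝ} {L : ℕ} {k : InputKind} {K m : ℕ} (loss : Vec m → Label K → ℝ)
    (τ : Measure (Sample d r L k K)) (M : Input d r L k → Vec m) : ℝ :=
  ∫ a, loss (M a.input) a.label ∂τ

/-- The empirical risk on the data `X`. -/
def empiricalRisk {d : ℕ} {r : ℝ} {L : ℕ} {k : InputKind} {K m N : ℕ}
    (loss : Vec m → Label K → ℝ) (X : Fin N → Sample d r L k K) (M : Input d r L k → Vec m) : ℝ :=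
  (1 / (N : ℝ)) * ∑ i, loss (M (X i).input) (X i).label

end MPNNGen

end

/-! Part (1) is an induction over layers. If `h` is bounded by `B` and `C`-Lipschitz for the ground
distance, then `∫ h` is Lipschitz for optimal transport with constant `max C B`: transported mass
pays `C` times its cost, and untransported mass pays `B` times the mass gap, which `OT` also charges
(`edist_integral_le_OT`). The IDM distance is a sum of such terms, so each layer stays bounded and
Lipschitz with constants that ignore dimensions. A graphon-signal reduces to its computation DIDM by
change of variables (`nodeFeature_eq`).

Part (2) rests on total boundedness and concentration. Finite partitions into small cells pass from
`c` to `OT c`: two measures with nearly equal cell masses are close, and cell masses can be rounded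
to finitely many values (`OT_le_of_cells`, `HasSmallCells.exists_code`). No triangle inequality for
`OT` is used.

For a cover by `n` balls of radius `ε`, Hoeffding's inequality and a union bound over all `2 ^ n`
unions of cells control the empirical frequencies. This bounds the error, uniformly over the
Lipschitz class, by twice the variation of the loss over a ball plus its oscillation `w` over the
centers times the deviation `t` (`abs_integral_sub_mean_le`). The condition `ξ(ε) ≤ N` bounds `t`.

The difficulty is that `w` involves the label diameter `√K`, while `B` does not depend on `K`.
Either `K` is small compared with `n`, and the slack in `n² log n` absorbs it, or few balls cover a
large cube, which forces `ε` to be of order `√K`, and then the oscillation of the loss alone gives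
the bound (`hasUniformBound_at_scale`). Finally `ε` tends to the infimum `ξ⁻¹(N)`, with the limsup
of the events (`HasUniformBound.of_tendsto`). -/

noncomputable section

namespace MPNNGen

/-! ### The space of measures of mass at most one -/

namespace SubProb

variable {X : Type} [MeasurableSpace X]

theorem measure_univ_le_one (μ : SubProb X) : (μ.1 : Measure X) Set.univ ≤ 1 := by
  rw [← FiniteMeasure.ennreal_mass]
  exact_mod_cast μ.2

theorem measurable_measure_apply {A : Set X} (hA : MeasurableSet A) :
    Measurable fun μ : SubProb X => (μ.1 : Measure X) A :=
  (Measure.measurable_coe hA).comp (measurable_subtype_coe.comp measurable_subtype_coe)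

variable [TopologicalSpace X] [BorelSpace X] [CompactSpace X] [T2Space X]

instance compactSpace : CompactSpace (SubProb X) :=
  isCompact_iff_compactSpace.mp
    (isCompact_setOfPred_finiteMeasure_le_of_compactSpace X 1)

variable [SecondCountableTopology X]

/-- Integrals of a dense sequence of continuous functions. -/
def denseIntegrals (X : Type) [MeasurableSpace X] [TopologicalSpace X] [CompactSpace X]
    [T2Space X] [SecondCountableTopology X] (μ : SubProb X) (n : ℕ) : ℝ :=
  ∫ x, TopologicalSpace.denseSeq C(X, ℝ) n x ∂(μ.1 : Measure X)

theorem continuous_denseIntegrals : Continuous (denseIntegrals X) :=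
  continuous_pi fun _ =>
    (FiniteMeasure.continuous_integral_continuousMap _).comp continuous_subtype_val

theorem continuous_integral_continuousMap_right (μ : SubProb X) :
    Continuous fun g : C(X, ℝ) => ∫ x, g x ∂(μ.1 : Measure X) := by
  have h : LipschitzWith 1 fun g : C(X, ℝ) => ∫ x, g x ∂(μ.1 : Measure X) := by
    refine LipschitzWith.of_dist_le_mul fun g g' => ?_
    have hi : ∀ f : C(X, ℝ), Integrable f (μ.1 : Measure X) := fun f =>
      f.continuous.integrable_of_hasCompactSupport (HasCompactSupport.of_compactSpace f)
    rw [Real.dist_eq, ← integral_sub (hi g) (hi g'), NNReal.coe_one, one_mul, ← Real.norm_eq_abs]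
    refine (norm_integral_le_of_norm_le_const (C := dist g g') (ae_of_all _ fun x => ?_)).trans ?_
    · rw [← dist_eq_norm]
      exact ContinuousMap.dist_apply_le_dist x
    · refine mul_le_of_le_one_right dist_nonneg ?_
      exact ENNReal.toReal_le_of_le_ofReal zero_le_one (by simpa using μ.measure_univ_le_one)
  exact h.continuous

theorem injective_denseIntegrals : Function.Injective (denseIntegrals X) := by
  intro μ ν h
  refine Subtype.ext (Subtype.ext ?_)
  refine ext_of_forall_integral_eq_of_IsFiniteMeasure (μ := (μ.1 : Measure X))
    (ν := (ν.1 : Measure X)) fun f => ?_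
  have key := (TopologicalSpace.denseRange_denseSeq C(X, ℝ)).equalizer
    (continuous_integral_continuousMap_right μ) (continuous_integral_continuousMap_right ν)
    (funext fun n => congrFun h n)
  exact congrFun key f.toContinuousMap

/-- A continuous injection of a compact space into the Hausdorff space `ℕ → ℝ`. Second countability
and a countable description of the Borel sets are inherited from there. -/
theorem isClosedEmbedding_denseIntegrals : IsClosedEmbedding (denseIntegrals X) :=
  continuous_denseIntegrals.isClosedEmbedding injective_denseIntegrals

instance secondCountableTopology : SecondCountableTopology (SubProb X) :=
  isClosedEmbedding_denseIntegrals.isEmbedding.secondCountableTopology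

theorem measurable_denseIntegrals : Measurable (denseIntegrals X) := by
  refine measurable_pi_lambda _ fun n => ?_
  have hm : Measurable fun μ : SubProb X => (μ.1 : Measure X) :=
    measurable_subtype_coe.comp measurable_subtype_coe
  set g := TopologicalSpace.denseSeq C(X, ℝ) n
  have hi : ∀ μ : SubProb X, Integrable g (μ.1 : Measure X) := fun μ =>
    g.continuous.integrable_of_hasCompactSupport (HasCompactSupport.of_compactSpace g)
  have : (fun μ : SubProb X => denseIntegrals X μ n) = fun μ : SubProb X =>
      (∫⁻ x, ENNReal.ofReal (g x) ∂(μ.1 : Measure X)).toReal -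
        (∫⁻ x, ENNReal.ofReal (-g x) ∂(μ.1 : Measure X)).toReal :=
    funext fun μ => integral_eq_lintegral_pos_part_sub_lintegral_neg_part (hi μ)
  rw [this]
  exact (((Measure.measurable_lintegral (by fun_prop)).comp hm).ennreal_toReal).sub
    (((Measure.measurable_lintegral (by fun_prop)).comp hm).ennreal_toReal)

/-- For closed sets the mass is a pointwise limit of weak-* continuous integrals; closed sets form a
generating π-system. -/
theorem borel_measurable_measure_apply {A : Set X} (hA : MeasurableSet A) :
    @Measurable _ _ (borel (SubProb X)) _ fun μ : SubProb X => (μ.1 : Measure X) A := by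
  let : MeasurableSpace (SubProb X) := borel _
  have : BorelSpace (SubProb X) := ⟨rfl⟩
  have hgen : ‹MeasurableSpace X› = MeasurableSpace.generateFrom {s : Set X | IsClosed s} := by
    rw [BorelSpace.measurable_eq (α := X), borel_eq_generateFrom_isClosed]
  have hclosed : ∀ F : Set X, IsClosed F →
      Measurable fun μ : SubProb X => (μ.1 : Measure X) F := by
    intro F hF
    refine measurable_of_tendsto_metrizable (f := fun n (μ : SubProb X) =>
      ∫⁻ x, hF.apprSeq n x ∂(μ.1 : Measure X)) (fun n => ?_) ?_
    · exact ((FiniteMeasure.continuous_lintegral_boundedContinuousFunction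
        (hF.apprSeq n)).comp continuous_subtype_val).measurable
    · exact tendsto_pi_nhds.2 fun μ =>
        HasOuterApproxClosed.tendsto_lintegral_apprSeq hF (μ.1 : Measure X)
  induction A, hA using MeasurableSpace.induction_on_inter hgen isPiSystem_isClosed with
  | empty => simp
  | basic t ht => exact hclosed t ht
  | compl t ht ih =>
    simp_rw [measure_compl ht (measure_ne_top _ _)]
    exact (hclosed _ isClosed_univ).sub ih
  | iUnion f hd hf ih =>
    simp_rw [measure_iUnion hd hf]
    exact Measurable.tsum ih

/-- The σ-algebra generated by the evaluations `μ ↦ μ A` is the weak-* Borel one. Evaluations are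
Borel, and conversely the embedding `denseIntegrals`, which induces the topology, is measurable for
the evaluations. -/
instance borelSpace : BorelSpace (SubProb X) := by
  refine ⟨le_antisymm ?_ ?_⟩
  · have h : @Measurable _ _ (borel (SubProb X)) _ fun μ : SubProb X => (μ.1 : Measure X) :=
      @Measure.measurable_of_measurable_coe _ _ _ (borel (SubProb X)) _
        fun A hA => borel_measurable_measure_apply hA
    rintro s ⟨t, ⟨u, hu, rfl⟩, rfl⟩
    exact h hu
  · rw [isClosedEmbedding_denseIntegrals.isInducing.eq_induced, borel_comap]
    have : borel (ℕ → ℝ) = (inferInstance : MeasurableSpace (ℕ → ℝ)) :=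
      (BorelSpace.measurable_eq (α := ℕ → ℝ)).symm
    rw [this]
    exact (measurable_denseIntegrals (X := X)).comap_le

end SubProb

/-! ### Topology and measurability of the spaces of iterated degree measures -/

theorem idmSpace_topology (d : ℕ) (r : ℝ) (L : ℕ) :
    CompactSpace (IDM d r L) ∧ T2Space (IDM d r L) ∧ SecondCountableTopology (IDM d r L) := by
  induction L with
  | zero =>
    refine ⟨?_, ?_, ?_⟩
    · exact isCompact_iff_compactSpace.mp (isCompact_closedBall (0 : Vec d) r)
    · exact inferInstanceAs (T2Space (Metric.closedBall (0 : Vec d) r))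
    · exact inferInstanceAs (SecondCountableTopology (Metric.closedBall (0 : Vec d) r))
  | succ L ih =>
    obtain ⟨_, _, _⟩ := ih
    refine ⟨?_, ?_, ?_⟩
    · exact inferInstanceAs (CompactSpace (IDM d r L × SubProb (IDM d r L)))
    · exact inferInstanceAs (T2Space (IDM d r L × SubProb (IDM d r L)))
    · exact inferInstanceAs (SecondCountableTopology (IDM d r L × SubProb (IDM d r L)))

instance (d : ℕ) (r : ℝ) (L : ℕ) : CompactSpace (IDM d r L) := (idmSpace_topology d r L).1

instance (d : ℕ) (r : ℝ) (L : ℕ) : T2Space (IDM d r L) := (idmSpace_topology d r L).2.1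

instance (d : ℕ) (r : ℝ) (L : ℕ) : SecondCountableTopology (IDM d r L) :=
  (idmSpace_topology d r L).2.2

namespace IDM

variable {d : ℕ} {r : ℝ} {L : ℕ}

theorem continuous_toVec : Continuous (toVec : IDM d r 0 → Vec d) :=
  continuous_subtype_val (p := fun x => x ∈ Metric.closedBall (0 : Vec d) r)

theorem norm_toVec_le (α : IDM d r 0) : ‖α.toVec‖ ≤ r :=
  mem_closedBall_zero_iff.1 (Subtype.property (p := fun x => x ∈ Metric.closedBall (0 : Vec d) r) α)

theorem continuous_init : Continuous (init : IDM d r (L + 1) → IDM d r L) :=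
  continuous_fst (X := IDM d r L) (Y := SubProb (IDM d r L))

theorem continuous_last : Continuous (last : IDM d r (L + 1) → SubProb (IDM d r L)) :=
  continuous_snd (X := IDM d r L) (Y := SubProb (IDM d r L))

theorem measurable_init : Measurable (init : IDM d r (L + 1) → IDM d r L) :=
  continuous_init.measurable

theorem measurable_last : Measurable (last : IDM d r (L + 1) → SubProb (IDM d r L)) :=
  continuous_last.measurable

/-- The target carries the Borel σ-algebra of a product; second countability makes it the product
σ-algebra. -/
theorem measurable_snoc {Ω : Type*} [MeasurableSpace Ω] {g : Ω → IDM d r L}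
    {h : Ω → SubProb (IDM d r L)} (hg : Measurable g) (hh : Measurable h) :
    Measurable fun ω => snoc (g ω) (h ω) := by
  have key : Measurable fun ω => (g ω, h ω) := hg.prodMk hh
  rw [BorelSpace.measurable_eq (α := IDM d r L × SubProb (IDM d r L))] at key
  exact key

instance (α : IDM d r (L + 1)) : IsFiniteMeasure α.lastMeasure :=
  inferInstanceAs (IsFiniteMeasure (α.last.1 : Measure (IDM d r L)))

theorem lastMeasure_univ_le_one (α : IDM d r (L + 1)) : α.lastMeasure Set.univ ≤ 1 :=
  SubProb.measure_univ_le_one α.last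

theorem measurable_lastMeasure_apply {A : Set (IDM d r L)} (hA : MeasurableSet A) :
    Measurable fun α : IDM d r (L + 1) => α.lastMeasure A :=
  (SubProb.measurable_measure_apply hA).comp measurable_last

end IDM

namespace GraphonSignal

variable {d : ℕ} {r : ℝ}

theorem measurable_edgeMeasure_map (G : GraphonSignal d r) {X : Type} [MeasurableSpace X]
    {g : I → X} (hg : Measurable g) : Measurable (G.pushEdge g) := by
  refine Measurable.subtype_mk (Measurable.subtype_mk ?_)
  refine Measure.measurable_of_measurable_coe _ fun A hA => ?_
  have : (fun x => (G.edgeMeasure x).map g A) =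
      fun x => ∫⁻ y in g ⁻¹' A, ENNReal.ofReal (G.W x y) := by
    funext x
    rw [Measure.map_apply hg hA, edgeMeasure, withDensity_apply _ (hg hA)]
  simp only [this]
  exact Measurable.lintegral_prod_right' (f := fun z : I × I => ENNReal.ofReal (G.W z.1 z.2))
    (G.measurable_W.ennreal_ofReal)

theorem measurable_compIDM (G : GraphonSignal d r) (L : ℕ) : Measurable (G.compIDM L) := by
  induction L with
  | zero => exact G.measurable_f
  | succ L ih => exact IDM.measurable_snoc ih (G.measurable_edgeMeasure_map ih)

instance (G : GraphonSignal d r) (L : ℕ) : IsProbabilityMeasure (G.compDIDM L) :=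
  Measure.isProbabilityMeasure_map (G.measurable_compIDM L).aemeasurable

end GraphonSignal

/-! ### Optimal transport: lower bounds by Lipschitz functions -/

section OptimalTransport

variable {X : Type*} [MeasurableSpace X]

/-- With `ρ` the part of `ν` that `γ` does not reach, the difference of integrals is `∫ (h ∘ p - h ∘
q) dγ - ∫ h dρ`, and `ρ` has mass equal to the mass gap. Keeping `p` and `q` abstract serves both
orders of the masses. -/
theorem edist_integral_le_of_map_le {E Z : Type*} [NormedAddCommGroup E] [NormedSpace ℝ E]
    [CompleteSpace E] [MeasurableSpace Z] {γ : Measure Z} {μ ν : Measure X} [IsFiniteMeasure μ]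
    [IsFiniteMeasure ν] {p q : Z → X} (hp : Measurable p) (hq : Measurable q) (hμ : γ.map p = μ)
    (hν : γ.map q ≤ ν) {h : X → E} (hh : StronglyMeasurable h) {B : ℝ} (hB : ∀ x, ‖h x‖ ≤ B)
    {C : ℝ≥0∞} (hC : C ≠ ⊤) {k : Z → ℝ≥0∞} (hk : ∀ z, edist (h (p z)) (h (q z)) ≤ C * k z) :
    edist (∫ x, h x ∂μ) (∫ x, h x ∂ν) ≤ C * ∫⁻ z, k z ∂γ +
      ENNReal.ofReal B * ENNReal.ofReal |μ.real Set.univ - ν.real Set.univ| := by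
  have hγμ : γ Set.univ = μ Set.univ := by
    rw [← hμ, Measure.map_apply hp MeasurableSet.univ, Set.preimage_univ]
  have hγq : γ.map q Set.univ = γ Set.univ := by
    rw [Measure.map_apply hq MeasurableSet.univ, Set.preimage_univ]
  have : IsFiniteMeasure γ := ⟨by rw [hγμ]; exact measure_lt_top _ _⟩
  set ρ := ν - γ.map q
  have hρ : ρ + γ.map q = ν := Measure.sub_add_cancel_of_le hν
  have hρν : ρ ≤ ν := Measure.sub_le
  have : IsFiniteMeasure ρ := isFiniteMeasure_of_le ν hρν
  have hint : ∀ (m : Measure X) [IsFiniteMeasure m], Integrable h m := fun m _ =>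
    .of_bound hh.aestronglyMeasurable B (ae_of_all _ hB)
  have hintγ : ∀ {f : Z → X}, Measurable f → Integrable (fun z => h (f z)) γ := fun hf =>
    .of_bound (hh.comp_measurable hf).aestronglyMeasurable B (ae_of_all _ fun z => hB _)
  have h1 : ∫ x, h x ∂μ = ∫ z, h (p z) ∂γ := by
    rw [← hμ, integral_map hp.aemeasurable hh.aestronglyMeasurable]
  have h2 : ∫ x, h x ∂ν = ∫ x, h x ∂ρ + ∫ z, h (q z) ∂γ := by
    rw [← hρ, integral_add_measure (hint _) (hint _),
      integral_map hq.aemeasurable hh.aestronglyMeasurable]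
  have h3 : ρ.real Set.univ = ν.real Set.univ - μ.real Set.univ := by
    have : ν.real Set.univ = ρ.real Set.univ + (γ.map q).real Set.univ := by
      rw [← hρ, measureReal_add_apply]
    rw [this, measureReal_def (γ.map q), hγq, hγμ, ← measureReal_def]
    ring
  have h4 : ∫ x, h x ∂μ - ∫ x, h x ∂ν = ∫ z, (h (p z) - h (q z)) ∂γ - ∫ x, h x ∂ρ := by
    rw [h1, h2, integral_sub (hintγ hp) (hintγ hq)]
    abel
  rw [edist_eq_enorm_sub, h4]
  refine (enorm_sub_le).trans (add_le_add ?_ ?_)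
  · calc ‖∫ z, (h (p z) - h (q z)) ∂γ‖ₑ ≤ ∫⁻ z, ‖h (p z) - h (q z)‖ₑ ∂γ :=
          enorm_integral_le_lintegral_enorm _
      _ ≤ ∫⁻ z, C * k z ∂γ := lintegral_mono fun z => by
          rw [← edist_eq_enorm_sub]
          exact hk z
      _ = C * ∫⁻ z, k z ∂γ := lintegral_const_mul' _ _ hC
  · calc ‖∫ x, h x ∂ρ‖ₑ ≤ ∫⁻ x, ‖h x‖ₑ ∂ρ := enorm_integral_le_lintegral_enorm _
      _ ≤ ∫⁻ _, ENNReal.ofReal B ∂ρ := lintegral_mono fun x => by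
          rw [← ofReal_norm]
          exact ENNReal.ofReal_le_ofReal (hB x)
      _ = ENNReal.ofReal B * ENNReal.ofReal (ρ.real Set.univ) := by
          rw [lintegral_const, ofReal_measureReal]
      _ ≤ _ := by
          gcongr
          rw [h3, abs_sub_comm]
          exact le_abs_self _

theorem edist_integral_le_OT {E : Type*} [NormedAddCommGroup E] [NormedSpace ℝ E]
    [CompleteSpace E] {μ ν : Measure X} [IsFiniteMeasure μ] [IsFiniteMeasure ν]
    {c : X → X → ℝ≥0∞} {h : X → E} (hh : StronglyMeasurable h) {B C : ℝ} (hC : 0 < C)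
    (hB : ∀ x, ‖h x‖ ≤ B) (hc : ∀ x y, edist (h x) (h y) ≤ ENNReal.ofReal C * c x y) :
    edist (∫ x, h x ∂μ) (∫ x, h x ∂ν) ≤ ENNReal.ofReal (max C B) * OT c μ ν := by
  have hK0 : ENNReal.ofReal (max C B) ≠ 0 := by
    rw [Ne, ENNReal.ofReal_eq_zero, not_le]
    exact lt_max_of_lt_left hC
  set m := ENNReal.ofReal |μ.real Set.univ - ν.real Set.univ| with hm
  have key : ∀ γ : Measure (X × X), IsCoupling μ ν γ →
      edist (∫ x, h x ∂μ) (∫ x, h x ∂ν) ≤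
        ENNReal.ofReal (max C B) * ((∫⁻ z, c z.1 z.2 ∂γ) + m) := by
    intro γ hγ
    have hmain : edist (∫ x, h x ∂μ) (∫ x, h x ∂ν) ≤
        ENNReal.ofReal C * (∫⁻ z, c z.1 z.2 ∂γ) + ENNReal.ofReal B * m := by
      rcases le_total (μ Set.univ) (ν Set.univ) with hle | hle
      · obtain ⟨h1, h2⟩ := hγ.1 hle
        exact edist_integral_le_of_map_le measurable_fst measurable_snd h1 h2 hh hB
          ENNReal.ofReal_ne_top fun z => hc _ _
      · obtain ⟨h1, h2⟩ := hγ.2 hle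
        rw [edist_comm, hm, abs_sub_comm]
        exact edist_integral_le_of_map_le measurable_snd measurable_fst h2 h1 hh hB
          ENNReal.ofReal_ne_top fun z => by rw [edist_comm]; exact hc _ _
    refine hmain.trans ?_
    rw [mul_add]
    gcongr
    · exact le_max_left _ _
    · exact le_max_right _ _
  -- Dividing by the nonzero finite constant isolates `OT`, so that the bound can be checked on each
  -- `γ` under the infimum; a `γ` that is not a coupling contributes `⊤`.
  rw [OT, mul_comm, ← ENNReal.div_le_iff_le_mul (Or.inl hK0) (Or.inl ENNReal.ofReal_ne_top),
    ENNReal.iInf_add]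
  refine le_iInf fun γ => ?_
  by_cases hγ : IsCoupling μ ν γ
  · simp only [hγ, iInf_pos]
    rw [ENNReal.div_le_iff_le_mul (Or.inl hK0) (Or.inl ENNReal.ofReal_ne_top),
      mul_comm]
    exact key γ hγ
  · simp [hγ]

theorem OT_self {c : X → X → ℝ≥0∞} (hc : ∀ x, c x x = 0) (μ : Measure X) : OT c μ μ = 0 := by
  have hd : Measurable fun x : X => (x, x) := by fun_prop
  have h1 : (μ.map fun x => (x, x)).map Prod.fst = μ := by
    rw [Measure.map_map measurable_fst hd]
    exact Measure.map_id
  have h2 : (μ.map fun x => (x, x)).map Prod.snd = μ := by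
    rw [Measure.map_map measurable_snd hd]
    exact Measure.map_id
  have h3 : ∫⁻ z, c z.1 z.2 ∂(μ.map fun x => (x, x)) = 0 := by
    refine le_antisymm ((lintegral_map_le _ _).trans ?_) zero_le
    simp [hc]
  rw [OT, sub_self, abs_zero, ENNReal.ofReal_zero, add_zero]
  refine le_antisymm (iInf_le_of_le _ (iInf_le_of_le ⟨fun _ => ⟨h1, h2.le⟩, fun _ => ⟨h1.le, h2⟩⟩
    h3.le)) zero_le

/-! ### Optimal transport: upper bounds by explicit couplings -/

/-- The product of two finite measures, normalized so as to be a coupling of them. -/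
def prodCoupling (μ ν : Measure X) : Measure (X × X) :=
  (max (μ Set.univ) (ν Set.univ))⁻¹ • μ.prod ν

theorem prodCoupling_univ_le (μ ν : Measure X) [IsFiniteMeasure μ] [IsFiniteMeasure ν] :
    prodCoupling μ ν Set.univ ≤ min (μ Set.univ) (ν Set.univ) := by
  rw [prodCoupling, Measure.smul_apply, smul_eq_mul, ← Set.univ_prod_univ, Measure.prod_prod]
  -- If both masses vanish, the normalizing factor is `⊤`, but `⊤ * 0 = 0`.
  rcases eq_or_ne (max (μ Set.univ) (ν Set.univ)) 0 with h | h
  · have : μ Set.univ = 0 := le_antisymm ((le_max_left _ _).trans h.le) zero_le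
    simp [this]
  · have ht : max (μ Set.univ) (ν Set.univ) ≠ ⊤ := by simp
    rw [← max_mul_min (μ Set.univ), ← mul_assoc, ENNReal.inv_mul_cancel h ht, one_mul]

theorem map_fst_prodCoupling (μ ν : Measure X) [IsFiniteMeasure μ] [IsFiniteMeasure ν] :
    (prodCoupling μ ν).map Prod.fst =
      ((max (μ Set.univ) (ν Set.univ))⁻¹ * ν Set.univ) • μ := by
  rw [prodCoupling, Measure.map_smul, Measure.map_fst_prod, smul_smul]

theorem map_snd_prodCoupling (μ ν : Measure X) [IsFiniteMeasure μ] [IsFiniteMeasure ν] :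
    (prodCoupling μ ν).map Prod.snd =
      ((max (μ Set.univ) (ν Set.univ))⁻¹ * μ Set.univ) • ν := by
  rw [prodCoupling, Measure.map_smul, Measure.map_snd_prod, smul_smul]

theorem smul_le_self_of_le_one {a : ℝ≥0∞} (ha : a ≤ 1) (μ : Measure X) : a • μ ≤ μ := by
  intro s
  rw [Measure.smul_apply, smul_eq_mul]
  exact mul_le_of_le_one_left zero_le ha

theorem isCoupling_prodCoupling (μ ν : Measure X) [IsFiniteMeasure μ] [IsFiniteMeasure ν] :
    IsCoupling μ ν (prodCoupling μ ν) := by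
  have hone : ∀ a : ℝ≥0∞, a ≤ max (μ Set.univ) (ν Set.univ) →
      (max (μ Set.univ) (ν Set.univ))⁻¹ * a ≤ 1 := fun a ha => by
    rw [mul_comm, ← div_eq_mul_inv]
    exact ENNReal.div_le_of_le_mul (by simpa using ha)
  refine ⟨fun hle => ⟨?_, ?_⟩, fun hle => ⟨?_, ?_⟩⟩
  · rw [map_fst_prodCoupling, max_eq_right hle]
    rcases eq_or_ne (ν Set.univ) 0 with h | h
    · have : μ = 0 := Measure.measure_univ_eq_zero.1 (le_antisymm (hle.trans h.le) zero_le)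
      simp [this]
    · rw [ENNReal.inv_mul_cancel h (measure_ne_top _ _), one_smul]
  · rw [map_snd_prodCoupling]
    exact smul_le_self_of_le_one (hone _ (le_max_left _ _)) _
  · rw [map_fst_prodCoupling]
    exact smul_le_self_of_le_one (hone _ (le_max_right _ _)) _
  · rw [map_snd_prodCoupling, max_eq_left hle]
    rcases eq_or_ne (μ Set.univ) 0 with h | h
    · have : ν = 0 := Measure.measure_univ_eq_zero.1 (le_antisymm (hle.trans h.le) zero_le)
      simp [this]
    · rw [ENNReal.inv_mul_cancel h (measure_ne_top _ _), one_smul]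

theorem IsCoupling.lintegral_add_le {c : X → X → ℝ≥0∞} {μ ν : Measure X} {γ : Measure (X × X)}
    (h : IsCoupling μ ν γ) :
    OT c μ ν ≤ (∫⁻ z, c z.1 z.2 ∂γ) + ENNReal.ofReal |μ.real Set.univ - ν.real Set.univ| := by
  rw [OT]
  gcongr
  exact iInf₂_le γ h

/-- Since the first pair is balanced, the order of the total masses is decided by the second pair
alone. -/
theorem IsCoupling.add {μ₁ ν₁ μ₂ ν₂ : Measure X} {γ₁ γ₂ : Measure (X × X)}
    (h₁ : IsCoupling μ₁ ν₁ γ₁) (h₂ : IsCoupling μ₂ ν₂ γ₂) (he : μ₁ Set.univ = ν₁ Set.univ)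
    (hf : ν₁ Set.univ ≠ ⊤) : IsCoupling (μ₁ + μ₂) (ν₁ + ν₂) (γ₁ + γ₂) := by
  simp only [IsCoupling, Measure.map_add _ _ measurable_fst, Measure.map_add _ _ measurable_snd,
    Measure.add_apply, he, ENNReal.add_le_add_iff_left hf]
  refine ⟨fun h => ?_, fun h => ?_⟩
  · rw [(h₁.1 he.le).1, (h₂.1 h).1, (h₁.2 he.ge).2]
    exact ⟨rfl, by gcongr; exact (h₂.1 h).2⟩
  · rw [(h₁.1 he.le).1, (h₁.2 he.ge).2, (h₂.2 h).2]
    exact ⟨by gcongr; exact (h₂.2 h).1, rfl⟩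

theorem IsCoupling.sum {ι : Type*} (s : Finset ι) {μ ν : ι → Measure X}
    {γ : ι → Measure (X × X)} (h : ∀ i, IsCoupling (μ i) (ν i) (γ i))
    (he : ∀ i, μ i Set.univ = ν i Set.univ) (hf : ∀ i, ν i Set.univ ≠ ⊤) :
    IsCoupling (∑ i ∈ s, μ i) (∑ i ∈ s, ν i) (∑ i ∈ s, γ i) := by
  classical
  induction s using Finset.induction_on with
  | empty => simp [IsCoupling]
  | insert i s hi ih =>
    simp only [Finset.sum_insert hi]
    exact (h i).add ih (he i) (hf i)

theorem sum_restrict_preimage_singleton {ι : Type*} [Fintype ι] [MeasurableSpace ι]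
    [MeasurableSingletonClass ι] {q : X → ι} (hq : Measurable q) (μ : Measure X) :
    ∑ i, μ.restrict (q ⁻¹' {i}) = μ := by
  ext s hs
  have : ∀ i, μ.restrict (q ⁻¹' {i}) s = μ.restrict s (q ⁻¹' {i}) := fun i => by
    rw [Measure.restrict_apply hs, Measure.restrict_apply (hq (measurableSet_singleton i)),
      Set.inter_comm]
  rw [Measure.finsetSum_apply, Finset.sum_congr rfl fun i _ => this i,
    sum_measure_preimage_singleton _ fun i _ => hq (measurableSet_singleton i)]
  simp

/-- In each cell the common mass `min (μ cell) (ν cell)` is matched at cost at most `ε`. What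
remains of `μ` has mass at most `η` per cell and is matched arbitrarily, at cost at most `D`; the
last term is the mass gap. -/
theorem OT_le_of_cells {ι : Type*} [Fintype ι] [MeasurableSpace ι] [MeasurableSingletonClass ι]
    {q : X → ι} (hq : Measurable q) {c : X → X → ℝ≥0∞} {ε D η : ℝ≥0∞}
    (hε : ∀ x y, q x = q y → c x y ≤ ε) (hD : ∀ x y, c x y ≤ D) {μ ν : Measure X}
    (hμ : μ Set.univ ≤ 1) (hν : ν Set.univ ≤ 1)
    (h₁ : ∀ i, μ (q ⁻¹' {i}) ≤ ν (q ⁻¹' {i}) + η)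
    (h₂ : ∀ i, ν (q ⁻¹' {i}) ≤ μ (q ⁻¹' {i}) + η) :
    OT c μ ν ≤ ε + D * (Fintype.card ι * η) + Fintype.card ι * η := by
  have : IsFiniteMeasure μ := ⟨hμ.trans_lt ENNReal.one_lt_top⟩
  have : IsFiniteMeasure ν := ⟨hν.trans_lt ENNReal.one_lt_top⟩
  have hqi : ∀ i, MeasurableSet (q ⁻¹' {i}) := fun i => hq (measurableSet_singleton i)
  set m : ι → ℝ≥0∞ := fun i => min (μ (q ⁻¹' {i})) (ν (q ⁻¹' {i})) with hm
  have hscale : ∀ a b : ℝ≥0∞, b ≤ a → a ≠ ⊤ → b * a⁻¹ ≤ 1 ∧ b * a⁻¹ * a = b := by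
    intro a b hba ha
    rcases eq_or_ne a 0 with rfl | h0
    · have : b = 0 := le_antisymm hba zero_le
      simp [this]
    · rw [mul_assoc, ENNReal.inv_mul_cancel h0 ha, mul_one]
      refine ⟨?_, rfl⟩
      calc b * a⁻¹ ≤ a * a⁻¹ := by gcongr
        _ = 1 := ENNReal.mul_inv_cancel h0 ha
  -- The fractions of the two measures in cell `i` that scale both down to the common mass; on an
  -- empty cell `0 * ⊤ = 0`.
  set α : ι → ℝ≥0∞ := fun i => m i * (μ (q ⁻¹' {i}))⁻¹
  set β : ι → ℝ≥0∞ := fun i => m i * (ν (q ⁻¹' {i}))⁻¹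
  have hα : ∀ i, α i ≤ 1 ∧ α i * μ (q ⁻¹' {i}) = m i := fun i =>
    hscale _ _ (min_le_left _ _) (measure_ne_top _ _)
  have hβ : ∀ i, β i ≤ 1 ∧ β i * ν (q ⁻¹' {i}) = m i := fun i =>
    hscale _ _ (min_le_right _ _) (measure_ne_top _ _)
  have hfin : ∀ (s : Set X) (a : ℝ≥0∞) (ρ : Measure X) [IsFiniteMeasure ρ], a ≤ 1 →
      IsFiniteMeasure (a • ρ.restrict s) := fun s a ρ _ ha =>
    isFiniteMeasure_of_le _ (smul_le_self_of_le_one ha _)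
  have hsplit : ∀ (ρ : Measure X) (a : ι → ℝ≥0∞), (∀ i, a i ≤ 1) →
      ∑ i, a i • ρ.restrict (q ⁻¹' {i}) + ∑ i, (1 - a i) • ρ.restrict (q ⁻¹' {i}) = ρ := by
    intro ρ a ha
    rw [← Finset.sum_add_distrib]
    simp only [← add_smul, add_tsub_cancel_of_le (ha _), one_smul]
    exact sum_restrict_preimage_singleton hq ρ
  set μ₁ : ι → Measure X := fun i => α i • μ.restrict (q ⁻¹' {i}) with hμ₁
  set ν₁ : ι → Measure X := fun i => β i • ν.restrict (q ⁻¹' {i}) with hν₁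
  set μ₂ : Measure X := ∑ i, (1 - α i) • μ.restrict (q ⁻¹' {i}) with hμ₂
  set ν₂ : Measure X := ∑ i, (1 - β i) • ν.restrict (q ⁻¹' {i}) with hν₂
  have hf₁ : ∀ i, IsFiniteMeasure (μ₁ i) := fun i => hfin _ _ _ (hα i).1
  have hf₂ : ∀ i, IsFiniteMeasure (ν₁ i) := fun i => hfin _ _ _ (hβ i).1
  have hμs : ∑ i, μ₁ i + μ₂ = μ := hsplit μ α fun i => (hα i).1
  have hνs : ∑ i, ν₁ i + ν₂ = ν := hsplit ν β fun i => (hβ i).1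
  have : IsFiniteMeasure μ₂ := isFiniteMeasure_of_le μ (hμs ▸ Measure.le_add_left le_rfl)
  have : IsFiniteMeasure ν₂ := isFiniteMeasure_of_le ν (hνs ▸ Measure.le_add_left le_rfl)
  have hmass₁ : ∀ i, μ₁ i Set.univ = m i := fun i => by
    simp only [hμ₁, Measure.smul_apply, smul_eq_mul, Measure.restrict_apply_univ, (hα i).2]
  have hmass₂ : ∀ i, ν₁ i Set.univ = m i := fun i => by
    simp only [hν₁, Measure.smul_apply, smul_eq_mul, Measure.restrict_apply_univ, (hβ i).2]
  have hcoup : IsCoupling μ ν (∑ i, prodCoupling (μ₁ i) (ν₁ i) + prodCoupling μ₂ ν₂) := by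
    have he : ∀ i, μ₁ i Set.univ = ν₁ i Set.univ := fun i => by rw [hmass₁, hmass₂]
    have := (IsCoupling.sum Finset.univ (fun i => isCoupling_prodCoupling (μ₁ i) (ν₁ i)) he
      fun i => measure_ne_top _ _).add (isCoupling_prodCoupling μ₂ ν₂)
      (by simp [Measure.finsetSum_apply, he]) (by
        rw [Measure.finsetSum_apply]
        exact (ENNReal.sum_lt_top.2 fun i _ => measure_lt_top _ _).ne)
    rwa [hμs, hνs] at this
  have hcell : ∀ i, ∫⁻ z, c z.1 z.2 ∂(prodCoupling (μ₁ i) (ν₁ i)) ≤ ε * m i := by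
    intro i
    have hc := isCoupling_prodCoupling (μ₁ i) (ν₁ i)
    have e1 := (hc.1 (by rw [hmass₁, hmass₂])).1
    have e2 := (hc.2 (by rw [hmass₁, hmass₂])).2
    have a1 : ∀ᵐ z ∂(prodCoupling (μ₁ i) (ν₁ i)), q z.1 = i := by
      refine ae_of_ae_map (p := fun x => q x = i) measurable_fst.aemeasurable ?_
      rw [e1]
      exact Measure.ae_smul_measure (ae_restrict_mem (hqi i)) _
    have a2 : ∀ᵐ z ∂(prodCoupling (μ₁ i) (ν₁ i)), q z.2 = i := by
      refine ae_of_ae_map (p := fun x => q x = i) measurable_snd.aemeasurable ?_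
      rw [e2]
      exact Measure.ae_smul_measure (ae_restrict_mem (hqi i)) _
    calc ∫⁻ z, c z.1 z.2 ∂(prodCoupling (μ₁ i) (ν₁ i))
        ≤ ∫⁻ _, ε ∂(prodCoupling (μ₁ i) (ν₁ i)) := by
          refine lintegral_mono_ae ?_
          filter_upwards [a1, a2] with z h1 h2
          exact hε _ _ (h1.trans h2.symm)
      _ = ε * prodCoupling (μ₁ i) (ν₁ i) Set.univ := lintegral_const _
      _ ≤ ε * m i := by
          gcongr
          exact (prodCoupling_univ_le _ _).trans ((min_le_left _ _).trans (hmass₁ i).le)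
  have hres : μ₂ Set.univ ≤ Fintype.card ι * η := by
    calc μ₂ Set.univ = ∑ i, (1 - α i) * μ (q ⁻¹' {i}) := by
          simp [hμ₂, Measure.finsetSum_apply]
      _ ≤ ∑ _i : ι, η := Finset.sum_le_sum fun i _ => by
          rw [ENNReal.sub_mul fun _ _ => measure_ne_top _ _, one_mul, (hα i).2, tsub_le_iff_left]
          rcases le_total (μ (q ⁻¹' {i})) (ν (q ⁻¹' {i})) with hle | hle
          · simp only [hm, min_eq_left hle]
            exact le_self_add
          · simp only [hm, min_eq_right hle]
            exact h₁ i
      _ = Fintype.card ι * η := by simp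
  have htot : ∀ (ρ κ : Measure X), (∀ i, ρ (q ⁻¹' {i}) ≤ κ (q ⁻¹' {i}) + η) →
      ρ Set.univ ≤ κ Set.univ + Fintype.card ι * η := by
    intro ρ κ h
    have hu : ∀ ρ : Measure X, ρ Set.univ = ∑ i, ρ (q ⁻¹' {i}) := fun ρ => by
      rw [sum_measure_preimage_singleton _ fun i _ => hqi i]
      simp
    rw [hu ρ, hu κ]
    calc ∑ i, ρ (q ⁻¹' {i}) ≤ ∑ i, (κ (q ⁻¹' {i}) + η) := Finset.sum_le_sum fun i _ => h i
      _ = _ := by simp [Finset.sum_add_distrib]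
  have hdiff : ENNReal.ofReal |μ.real Set.univ - ν.real Set.univ| ≤ Fintype.card ι * η := by
    have hsub : ∀ (ρ κ : Measure X) [IsFiniteMeasure ρ] [IsFiniteMeasure κ],
        ρ Set.univ ≤ κ Set.univ + Fintype.card ι * η →
        ENNReal.ofReal (ρ.real Set.univ - κ.real Set.univ) ≤ Fintype.card ι * η := by
      intro ρ κ _ _ h
      rw [ENNReal.ofReal_sub _ measureReal_nonneg, ofReal_measureReal, ofReal_measureReal]
      exact tsub_le_iff_left.2 h
    rcases abs_cases (μ.real Set.univ - ν.real Set.univ) with ⟨h, _⟩ | ⟨h, _⟩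
    · rw [h]
      exact hsub μ ν (htot _ _ h₁)
    · rw [h, neg_sub]
      exact hsub ν μ (htot _ _ h₂)
  refine hcoup.lintegral_add_le.trans (add_le_add ?_ hdiff)
  rw [lintegral_add_measure, lintegral_finsetSum_measure]
  refine add_le_add ?_ ?_
  · calc ∑ i, ∫⁻ z, c z.1 z.2 ∂(prodCoupling (μ₁ i) (ν₁ i)) ≤ ∑ i, ε * m i :=
          Finset.sum_le_sum fun i _ => hcell i
      _ = ε * (∑ i, μ₁ i) Set.univ := by
          simp only [← Finset.mul_sum, Measure.finsetSum_apply, hmass₁]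
      _ ≤ ε * 1 := by
          gcongr
          refine le_trans ?_ hμ
          conv_rhs => rw [← hμs]
          exact le_self_add
      _ = ε := mul_one _
  · calc ∫⁻ z, c z.1 z.2 ∂(prodCoupling μ₂ ν₂) ≤ ∫⁻ _, D ∂(prodCoupling μ₂ ν₂) :=
          lintegral_mono fun z => hD _ _
      _ = D * prodCoupling μ₂ ν₂ Set.univ := lintegral_const _
      _ ≤ D * (Fintype.card ι * η) := by
          gcongr
          exact (prodCoupling_univ_le _ _).trans ((min_le_left _ _).trans hres)

end OptimalTransport

/-! ### Message passing neural networks are bounded and Lipschitz -/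

theorem dIDM_self {d : ℕ} {r : ℝ} (L : ℕ) (α : IDM d r L) : dIDM d r L α α = 0 := by
  induction L with
  | zero => exact edist_self α.toVec
  | succ L ih => simp only [dIDM, ih, OT_self ih, add_zero]

theorem inputDist_self {d : ℕ} {r : ℝ} {L : ℕ} (k : InputKind) (x : Input d r L k) :
    inputDist d r L k x x = 0 := by
  cases k with
  | didm => exact OT_self (dIDM_self L) _
  | graphonSignal => exact OT_self (dIDM_self L) _

theorem norm_toLp_prod_le {E F : Type*} [SeminormedAddCommGroup E] [SeminormedAddCommGroup F]
    (a : E) (b : F) : ‖WithLp.toLp 2 (a, b)‖ ≤ ‖a‖ + ‖b‖ := by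
  rw [WithLp.prod_norm_eq_of_L2]
  refine Real.sqrt_le_iff.2 ⟨by positivity, ?_⟩
  change ‖a‖ ^ 2 + ‖b‖ ^ 2 ≤ _
  nlinarith [norm_nonneg a, norm_nonneg b]

theorem edist_toLp_prod_le {E F : Type*} [SeminormedAddCommGroup E] [SeminormedAddCommGroup F]
    (a a' : E) (b b' : F) :
    edist (WithLp.toLp 2 (a, b)) (WithLp.toLp 2 (a', b')) ≤ edist a a' + edist b b' := by
  rw [edist_dist, edist_dist, edist_dist, ← ENNReal.ofReal_add dist_nonneg dist_nonneg,
    dist_eq_norm, dist_eq_norm, dist_eq_norm]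
  exact ENNReal.ofReal_le_ofReal (norm_toLp_prod_le (a - a') (b - b'))

/-- The weak-* topology tests real-valued functions, hence the passage through coordinates. -/
theorem IDM.continuous_integral_lastMeasure {d n L : ℕ} {r : ℝ} {h : IDM d r L → Vec n}
    (hh : Continuous h) :
    Continuous fun α : IDM d r (L + 1) => ∫ β, h β ∂α.lastMeasure := by
  have hi : ∀ α : IDM d r (L + 1), Integrable h α.lastMeasure := fun α =>
    hh.integrable_of_hasCompactSupport (HasCompactSupport.of_compactSpace h)
  have key : Continuous fun (α : IDM d r (L + 1)) (i : Fin n) => ∫ β, h β i ∂α.lastMeasure := by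
    refine continuous_pi fun i => ?_
    have hc : Continuous fun β => h β i := (EuclideanSpace.proj (𝕜 := ℝ) i).continuous.comp hh
    exact (FiniteMeasure.continuous_integral_continuousMap (⟨_, hc⟩ : C(IDM d r L, ℝ))).comp
      (continuous_subtype_val.comp IDM.continuous_last)
  have := (PiLp.continuous_toLp 2 (fun _ : Fin n => ℝ)).comp key
  refine this.congr fun α => ?_
  ext i
  exact (EuclideanSpace.proj (𝕜 := ℝ) i).integral_comp_comm (hi α)

theorem norm_integral_le_of_measure_univ_le_one {X E : Type*} [MeasurableSpace X]
    [NormedAddCommGroup E] [NormedSpace ℝ E] {μ : Measure X} (hμ : μ Set.univ ≤ 1) {h : X → E}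
    {B : ℝ} (hB0 : 0 ≤ B) (hB : ∀ x, ‖h x‖ ≤ B) : ‖∫ x, h x ∂μ‖ ≤ B := by
  have : IsFiniteMeasure μ := ⟨hμ.trans_lt ENNReal.one_lt_top⟩
  refine (norm_integral_le_of_norm_le_const (ae_of_all _ hB)).trans ?_
  refine mul_le_of_le_one_right hB0 ?_
  exact ENNReal.toReal_le_of_le_ofReal zero_le_one (by simpa using hμ)

theorem norm_le_of_lipschitzWith {E F : Type*} [SeminormedAddCommGroup E]
    [SeminormedAddCommGroup F] {A₁ A₂ : ℝ} (hA₁ : 0 ≤ A₁) {φ : E → F}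
    (hφ : LipschitzWith A₁.toNNReal φ) (h0 : ‖φ 0‖ ≤ A₂) {x : E} {R : ℝ} (hx : ‖x‖ ≤ R) :
    ‖φ x‖ ≤ A₁ * R + A₂ := by
  have h1 := hφ.dist_le_mul x 0
  rw [dist_zero_right, Real.coe_toNNReal _ hA₁, dist_eq_norm] at h1
  have h2 : ‖φ x‖ ≤ ‖φ x - φ 0‖ + ‖φ 0‖ := by simpa using norm_add_le (φ x - φ 0) (φ 0)
  nlinarith

/-- A bound on the hidden representations of layer `t`. -/
def featureBound (r A₁ A₂ : ℝ) : ℕ → ℝ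
  | 0 => A₁ * r + A₂
  | t + 1 => A₁ * (featureBound r A₁ A₂ t + featureBound r A₁ A₂ t) + A₂

/-- A Lipschitz constant of the hidden representations of layer `t`. -/
def featureLip (r A₁ A₂ : ℝ) : ℕ → ℝ
  | 0 => A₁
  | t + 1 => A₁ * (featureLip r A₁ A₂ t + featureBound r A₁ A₂ t)

theorem featureBound_pos {r A₁ A₂ : ℝ} (hr : 0 < r) (h₁ : 0 < A₁) (h₂ : 0 < A₂) (t : ℕ) :
    0 < featureBound r A₁ A₂ t := by
  induction t with
  | zero => unfold featureBound; positivity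
  | succ t ih => unfold featureBound; positivity

theorem featureLip_pos {r A₁ A₂ : ℝ} (hr : 0 < r) (h₁ : 0 < A₁) (h₂ : 0 < A₂) (t : ℕ) :
    0 < featureLip r A₁ A₂ t := by
  induction t with
  | zero => exact h₁
  | succ t ih =>
    have := featureBound_pos hr h₁ h₂ t
    unfold featureLip
    positivity

namespace MPNN

variable {d L m : ℕ} {r A₁ A₂ : ℝ}

theorem idmFeature_regular (hr : 0 < r) (h₁ : 0 < A₁) (h₂ : 0 < A₂) {Φ : MPNN d L m}
    (hΦ : Φ.MemTheta A₁ A₂) (t : ℕ) (ht : t ≤ L) :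
    Continuous (Φ.idmFeature r t) ∧ (∀ α, ‖Φ.idmFeature r t α‖ ≤ featureBound r A₁ A₂ t) ∧
      ∀ α β, edist (Φ.idmFeature r t α) (Φ.idmFeature r t β) ≤
        ENNReal.ofReal (featureLip r A₁ A₂ t) * dIDM d r t α β := by
  induction t with
  | zero =>
    refine ⟨hΦ.1.1.continuous.comp IDM.continuous_toVec, fun α => ?_, fun α β => ?_⟩
    · exact norm_le_of_lipschitzWith h₁.le hΦ.1.1 hΦ.1.2 α.norm_toVec_le
    · exact hΦ.1.1 _ _
  | succ t ih =>
    obtain ⟨hc, hb, hl⟩ := ih (by omega)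
    obtain ⟨hu, hu0⟩ := hΦ.2.1 t (by omega)
    have hB := featureBound_pos hr h₁ h₂ t
    have hC := featureLip_pos hr h₁ h₂ t
    refine ⟨?_, fun α => ?_, fun α β => ?_⟩
    · exact hu.continuous.comp ((WithLp.prod_continuous_toLp 2 _ _).comp
        ((hc.comp IDM.continuous_init).prodMk (IDM.continuous_integral_lastMeasure hc)))
    · refine norm_le_of_lipschitzWith h₁.le hu hu0 ((norm_toLp_prod_le _ _).trans ?_)
      exact add_le_add (hb _)
        (norm_integral_le_of_measure_univ_le_one α.lastMeasure_univ_le_one hB.le hb)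
    · refine (hu _ _).trans ?_
      have hI := edist_integral_le_OT (μ := α.lastMeasure) (ν := β.lastMeasure)
        hc.stronglyMeasurable hC hb hl
      rw [featureLip, ENNReal.ofReal_mul h₁.le, mul_assoc]
      refine mul_le_mul' le_rfl ((edist_toLp_prod_le _ _ _ _).trans ?_)
      -- The two summands of the distance match the two arguments of the update: the first costs
      -- `featureLip`, the second `max featureLip featureBound`. Their sum dominates both, whence
      -- the recursion for `featureLip`.
      rw [dIDM, mul_add]
      refine add_le_add ((hl _ _).trans ?_) (hI.trans ?_)
      · gcongr
        linarith
      · gcongr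
        exact max_le (by linarith) (by linarith)

/-- The neighbourhood integral against `W(x, ·)` is the integral against the last entry of the
computation IDM; continuity of the lower layers supplies the measurability for this change of
variables. -/
theorem nodeFeature_eq (Φ : MPNN d L m) (G : GraphonSignal d r) (t : ℕ)
    (hc : ∀ s < t, Continuous (Φ.idmFeature r s)) (x : I) :
    Φ.nodeFeature G t x = Φ.idmFeature r t (G.compIDM t x) := by
  induction t generalizing x with
  | zero => rfl
  | succ t ih =>
    have ih' := ih fun s hs => hc s (by omega)
    have hI : ∫ y, G.W x y • Φ.nodeFeature G t y =
        ∫ β, Φ.idmFeature r t β ∂(G.compIDM (t + 1) x).lastMeasure := by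
      change _ = ∫ β, Φ.idmFeature r t β ∂((G.edgeMeasure x).map (G.compIDM t))
      rw [integral_map (G.measurable_compIDM t).aemeasurable
        (hc t (by omega)).stronglyMeasurable.aestronglyMeasurable, GraphonSignal.edgeMeasure,
        integral_withDensity_eq_integral_toReal_smul]
      · refine integral_congr_ae (ae_of_all _ fun y => ?_)
        simp only [ENNReal.toReal_ofReal (G.nonneg_W x y), ih']
      · exact (G.measurable_W.comp measurable_prodMk_left).ennreal_ofReal
      · exact ae_of_all _ fun y => ENNReal.ofReal_lt_top
    simp only [nodeFeature, idmFeature]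
    rw [hI, ih']
    rfl

theorem output_mem_lipClass (hr : 0 < r) (h₁ : 0 < A₁) (h₂ : 0 < A₂) {Φ : MPNN d L m}
    (hΦ : Φ.MemTheta A₁ A₂) (k : InputKind) :
    Φ.output r k ∈ LipClass (inputDist d r L k) m
      (A₁ * (featureLip r A₁ A₂ L + featureBound r A₁ A₂ L))
      (A₁ * featureBound r A₁ A₂ L + A₂) := by
  obtain ⟨hc, hb, hl⟩ := idmFeature_regular hr h₁ h₂ hΦ L le_rfl
  obtain ⟨hu, hu0⟩ := hΦ.2.2
  have hB := featureBound_pos hr h₁ h₂ L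
  have hC := featureLip_pos hr h₁ h₂ L
  have hlip : ∀ (μ ν : Measure (IDM d r L)) [IsFiniteMeasure μ] [IsFiniteMeasure ν],
      edist (Φ.readout (∫ α, Φ.idmFeature r L α ∂μ)) (Φ.readout (∫ α, Φ.idmFeature r L α ∂ν)) ≤
        ENNReal.ofReal (A₁ * (featureLip r A₁ A₂ L + featureBound r A₁ A₂ L)) *
          OT (dIDM d r L) μ ν := by
    intro μ ν _ _
    refine (hu _ _).trans ?_
    rw [ENNReal.ofReal_mul h₁.le, mul_assoc]
    refine mul_le_mul' le_rfl ((edist_integral_le_OT hc.stronglyMeasurable hC hb hl).trans ?_)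
    gcongr
    exact max_le (by linarith) (by linarith)
  have hbd : ∀ (μ : Measure (IDM d r L)) [IsProbabilityMeasure μ],
      ‖Φ.readout (∫ α, Φ.idmFeature r L α ∂μ)‖ ≤ A₁ * featureBound r A₁ A₂ L + A₂ := by
    intro μ _
    exact norm_le_of_lipschitzWith h₁.le hu hu0
      (norm_integral_le_of_measure_univ_le_one (by simp) hB.le hb)
  cases k with
  | didm =>
    exact ⟨fun (μ ν : ProbabilityMeasure (IDM d r L)) => hlip μ ν,
      fun (μ : ProbabilityMeasure (IDM d r L)) => hbd μ⟩
  | graphonSignal =>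
    have hout : ∀ G : GraphonSignal d r, Φ.output r .graphonSignal G =
        Φ.readout (∫ α, Φ.idmFeature r L α ∂(G.compDIDM L)) := by
      intro G
      rw [GraphonSignal.compDIDM, integral_map (G.measurable_compIDM L).aemeasurable
        hc.stronglyMeasurable.aestronglyMeasurable]
      simp only [output, Φ.nodeFeature_eq G L
        fun s hs => (idmFeature_regular hr h₁ h₂ hΦ s hs.le).1]
    refine ⟨fun (G G' : GraphonSignal d r) => ?_, fun (G : GraphonSignal d r) => ?_⟩
    · rw [hout, hout]
      exact hlip _ _
    · rw [hout]
      exact hbd _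

end MPNN

/-! ### Total boundedness -/

/-- The index of the interval of length `1 / k` that contains `v`. -/
def massCode (k : ℕ) (v : ℝ≥0∞) : Fin (k + 1) := Fin.ofNat (k + 1) ⌊(k : ℝ) * v.toReal⌋₊

theorem measurable_massCode (k : ℕ) : Measurable (massCode k) := by
  have : Measurable fun n : ℕ => Fin.ofNat (k + 1) n := measurable_of_countable _
  exact this.comp (Nat.measurable_floor.comp (ENNReal.measurable_toReal.const_mul _))

theorem le_add_inv_of_massCode_eq {k : ℕ} (hk : 0 < k) {v w : ℝ≥0∞} (hv : v ≤ 1) (hw : w ≤ 1)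
    (h : massCode k v = massCode k w) : v ≤ w + (k : ℝ≥0∞)⁻¹ := by
  have hk' : (0 : ℝ) < k := by exact_mod_cast hk
  -- Masses at most one give floors in `0, …, k`, so the reduction modulo `k + 1` in `Fin.ofNat`
  -- changes nothing.
  have hle : ∀ u : ℝ≥0∞, u ≤ 1 → ⌊(k : ℝ) * u.toReal⌋₊ < k + 1 := by
    intro u hu
    have h1 : u.toReal ≤ 1 := ENNReal.toReal_le_of_le_ofReal zero_le_one (by simpa using hu)
    refine Nat.lt_succ_of_le (Nat.floor_le_of_le ?_)
    exact mul_le_of_le_one_right hk'.le h1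
  have hfl : ⌊(k : ℝ) * v.toReal⌋₊ = ⌊(k : ℝ) * w.toReal⌋₊ := by
    have h2 := congrArg Fin.val h
    simp only [massCode, Fin.ofNat] at h2
    rwa [Nat.mod_eq_of_lt (hle v hv), Nat.mod_eq_of_lt (hle w hw)] at h2
  have h3 : (k : ℝ) * v.toReal < (k : ℝ) * w.toReal + 1 := by
    have h4 := Nat.lt_floor_add_one ((k : ℝ) * v.toReal)
    have h5 := Nat.floor_le (show 0 ≤ (k : ℝ) * w.toReal by positivity)
    rw [hfl] at h4
    linarith
  have h6 : v.toReal ≤ w.toReal + (k : ℝ)⁻¹ := by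
    have : v.toReal * k ≤ (w.toReal + (k : ℝ)⁻¹) * k := by
      rw [add_mul, inv_mul_cancel₀ hk'.ne']
      linarith
    exact le_of_mul_le_mul_right this hk'
  have hvt : v ≠ ⊤ := (hv.trans_lt ENNReal.one_lt_top).ne
  have hwt : w ≠ ⊤ := (hw.trans_lt ENNReal.one_lt_top).ne
  rw [← ENNReal.ofReal_toReal hvt, ← ENNReal.ofReal_toReal hwt, ← ENNReal.ofReal_natCast k,
    ← ENNReal.ofReal_inv_of_pos hk', ← ENNReal.ofReal_add ENNReal.toReal_nonneg (by positivity)]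
  exact ENNReal.ofReal_le_ofReal h6

/-- `c` is bounded, and the space has finite measurable partitions into cells of arbitrarily small
diameter with respect to `c`. -/
def HasSmallCells {X : Type*} [MeasurableSpace X] (c : X → X → ℝ≥0∞) : Prop :=
  (∃ D : ℝ≥0∞, D ≠ ⊤ ∧ ∀ x y, c x y ≤ D) ∧
    ∀ ε : ℝ≥0∞, ε ≠ 0 → ∃ (n : ℕ) (q : X → Fin n), Measurable q ∧ ∀ x y, q x = q y → c x y ≤ ε

/-- Cells of diameter `ε / 2` cost `ε / 2`. Equal codes make the cell masses agree up to `1 / k`,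
and `k` is taken so large that the other terms, `(D + 1) n / k`, are at most `ε / 2`. -/
theorem HasSmallCells.exists_code {X : Type*} [MeasurableSpace X] {c : X → X → ℝ≥0∞}
    (hc : HasSmallCells c) {ε : ℝ≥0∞} (hε : ε ≠ 0) :
    ∃ (n k : ℕ) (q : X → Fin n), Measurable q ∧ ∀ μ ν : Measure X, μ Set.univ ≤ 1 →
      ν Set.univ ≤ 1 →
      (∀ i, massCode k (μ (q ⁻¹' {i})) = massCode k (ν (q ⁻¹' {i}))) → OT c μ ν ≤ ε := by
  obtain ⟨⟨D, hDt, hD⟩, hcell⟩ := hc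
  have hε2 : ε / 2 ≠ 0 := by simp [hε]
  obtain ⟨n, q, hq, hcl⟩ := hcell (ε / 2) hε2
  have hfin : (D + 1) * n / (ε / 2) ≠ ⊤ :=
    ENNReal.div_ne_top (ENNReal.mul_ne_top (by simp [hDt]) (by simp)) hε2
  obtain ⟨k, hk⟩ := ENNReal.exists_nat_gt hfin
  have hk0 : 0 < k := Nat.pos_of_ne_zero fun h => by simp [h] at hk
  refine ⟨n, k, q, hq, fun μ ν hμ hν h => ?_⟩
  have hle : ∀ ρ : Measure X, ρ Set.univ ≤ 1 → ∀ s, ρ s ≤ 1 := fun ρ hρ s =>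
    (measure_mono (Set.subset_univ s)).trans hρ
  refine (OT_le_of_cells (η := (k : ℝ≥0∞)⁻¹) hq hcl hD hμ hν
    (fun i => le_add_inv_of_massCode_eq hk0 (hle _ hμ _) (hle _ hν _) (h i))
    (fun i => le_add_inv_of_massCode_eq hk0 (hle _ hν _) (hle _ hμ _) (h i).symm)).trans ?_
  have hsmall : (D + 1) * n * (k : ℝ≥0∞)⁻¹ ≤ ε / 2 := by
    rw [← div_eq_mul_inv]
    refine ENNReal.div_le_of_le_mul ?_
    rcases eq_or_ne (ε / 2) ⊤ with ht | ht
    · rw [ht, ENNReal.top_mul (by exact_mod_cast hk0.ne')]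
      exact le_top
    · rw [mul_comm (ε / 2)]
      exact (ENNReal.div_le_iff_le_mul (Or.inl hε2) (Or.inl ht)).1 hk.le
  calc ε / 2 + D * (Fintype.card (Fin n) * (k : ℝ≥0∞)⁻¹) + Fintype.card (Fin n) * (k : ℝ≥0∞)⁻¹
      = ε / 2 + (D + 1) * n * (k : ℝ≥0∞)⁻¹ := by
        rw [Fintype.card_fin]
        ring
    _ ≤ ε / 2 + ε / 2 := by gcongr
    _ = ε := ENNReal.add_halves ε

theorem OT_le_of_le {X : Type*} [MeasurableSpace X] {c : X → X → ℝ≥0∞} {D : ℝ≥0∞}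
    (hD : ∀ x y, c x y ≤ D) {μ ν : Measure X} (hμ : μ Set.univ ≤ 1) (hν : ν Set.univ ≤ 1) :
    OT c μ ν ≤ D + D + 1 := by
  have hle : ∀ ρ κ : Measure X, ρ Set.univ ≤ 1 → ∀ i : Unit,
      ρ ((fun _ => ()) ⁻¹' {i}) ≤ κ ((fun _ => ()) ⁻¹' {i}) + 1 := fun ρ κ hρ _ =>
    ((measure_mono (Set.subset_univ _)).trans hρ).trans le_add_self
  -- A single cell, with error one.
  simpa using OT_le_of_cells (q := fun _ : X => ()) (η := 1) measurable_const (fun x y _ => hD x y)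
    hD hμ hν (hle _ _ hμ) (hle _ _ hν)

/-- The cells group points by their nearest point among finitely many terms of a dense sequence. -/
theorem hasSmallCells_edist {Y : Type*} [MetricSpace Y] [CompactSpace Y] [Nonempty Y]
    [MeasurableSpace Y] [BorelSpace Y] : HasSmallCells fun x y : Y => edist x y := by
  refine ⟨⟨ENNReal.ofReal (Metric.diam (Set.univ : Set Y)), ENNReal.ofReal_ne_top, fun x y => ?_⟩,
    fun ε hε => ?_⟩
  · simp only [edist_dist]
    exact ENNReal.ofReal_le_ofReal (Metric.dist_le_diam_of_mem isCompact_univ.isBounded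
      (Set.mem_univ x) (Set.mem_univ y))
  · set e := TopologicalSpace.denseSeq Y
    have hε2 : 0 < ε / 2 := by simpa [pos_iff_ne_zero] using hε
    obtain ⟨t, ht⟩ := isCompact_univ.elim_finite_subcover (fun n => Metric.eball (e n) (ε / 2))
      (fun n => Metric.isOpen_eball) fun x _ => by
        obtain ⟨y, hy, hxy⟩ := EMetric.mem_closure_iff.1
          (TopologicalSpace.denseRange_denseSeq Y x) (ε / 2) hε2
        obtain ⟨n, rfl⟩ := hy
        exact Set.mem_iUnion.2 ⟨n, hxy⟩
    set N := t.sup id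
    have hnear : ∀ x, edist (e (SimpleFunc.nearestPtInd e N x)) x ≤ ε / 2 := by
      intro x
      obtain ⟨n, hn, hx⟩ := Set.mem_iUnion₂.1 (ht (Set.mem_univ x))
      have h1 : edist (SimpleFunc.nearestPt e N x) x ≤ edist (e n) x :=
        SimpleFunc.edist_nearestPt_le e x (Finset.le_sup (f := id) hn)
      refine h1.trans ?_
      rw [edist_comm]
      exact (Metric.mem_eball.1 hx).le
    refine ⟨N + 1, fun x => Fin.ofNat (N + 1) (SimpleFunc.nearestPtInd e N x), ?_, ?_⟩
    · exact (measurable_of_countable fun n : ℕ => Fin.ofNat (N + 1) n).comp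
        (SimpleFunc.measurable _)
    · intro x y hxy
      have h2 := congrArg Fin.val hxy
      simp only [Fin.ofNat] at h2
      rw [Nat.mod_eq_of_lt (Nat.lt_succ_of_le (SimpleFunc.nearestPtInd_le e N x)),
        Nat.mod_eq_of_lt (Nat.lt_succ_of_le (SimpleFunc.nearestPtInd_le e N y))] at h2
      calc edist x y ≤ edist x (e (SimpleFunc.nearestPtInd e N x)) +
            edist (e (SimpleFunc.nearestPtInd e N x)) y := edist_triangle _ _ _
        _ ≤ ε / 2 + ε / 2 := by
            refine add_le_add ?_ ?_
            · rw [edist_comm]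
              exact hnear x
            · rw [h2]
              exact hnear y
        _ = ε := ENNReal.add_halves ε

/-- An element of the next level is coded by the cell of its initial part and the rounded cell
masses of its last measure; this code is measurable because evaluations of measures are. -/
theorem hasSmallCells_dIDM (d : ℕ) {r : ℝ} (hr : 0 < r) (L : ℕ) :
    HasSmallCells (dIDM d r L) := by
  induction L with
  | zero =>
    have : CompactSpace (Metric.closedBall (0 : Vec d) r) :=
      isCompact_iff_compactSpace.mp (isCompact_closedBall (0 : Vec d) r)
    have : Nonempty (Metric.closedBall (0 : Vec d) r) := ⟨⟨0, by simp [hr.le]⟩⟩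
    exact hasSmallCells_edist (Y := Metric.closedBall (0 : Vec d) r)
  | succ L ih =>
    refine ⟨?_, fun ε hε => ?_⟩
    · obtain ⟨D, hDt, hD⟩ := ih.1
      refine ⟨D + (D + D + 1), by simp [hDt], fun α β => add_le_add (hD _ _) ?_⟩
      exact OT_le_of_le hD α.lastMeasure_univ_le_one β.lastMeasure_univ_le_one
    · have hε2 : ε / 2 ≠ 0 := by simp [hε]
      obtain ⟨n₁, q₁, hq₁, hc₁⟩ := ih.2 (ε / 2) hε2
      obtain ⟨n, k, q, hq, hc⟩ := ih.exists_code hε2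
      have hm : Measurable fun α : IDM d r (L + 1) =>
          (q₁ α.init, fun i => massCode k (α.lastMeasure (q ⁻¹' {i}))) :=
        (hq₁.comp IDM.measurable_init).prodMk (measurable_pi_lambda _ fun i =>
          (measurable_massCode k).comp
            (IDM.measurable_lastMeasure_apply (hq (measurableSet_singleton i))))
      refine ⟨_, fun α => Fintype.equivFin (Fin n₁ × (Fin n → Fin (k + 1)))
        (q₁ α.init, fun i => massCode k (α.lastMeasure (q ⁻¹' {i}))),
        (measurable_of_countable _).comp hm, fun α β h => ?_⟩
      obtain ⟨h1, h2⟩ := Prod.ext_iff.1 ((Fintype.equivFin _).injective h)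
      calc dIDM d r (L + 1) α β ≤ ε / 2 + ε / 2 := add_le_add (hc₁ _ _ h1)
            (hc _ _ α.lastMeasure_univ_le_one β.lastMeasure_univ_le_one fun i => congrFun h2 i)
        _ = ε := ENNReal.add_halves ε

theorem exists_coveredBy_of_code {X ι : Type*} [Finite ι] {dist : X → X → ℝ≥0∞} {ε : ℝ}
    (code : X → ι) (h : ∀ x y, code x = code y → dist x y < ENNReal.ofReal ε) :
    ∃ n, CoveredBy dist ε n := by
  have := Fintype.ofFinite (Set.range code)
  refine ⟨Fintype.card (Set.range code),
    fun i => ((Fintype.equivFin (Set.range code)).symm i).2.choose, fun x => ?_⟩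
  refine ⟨Fintype.equivFin (Set.range code) ⟨code x, x, rfl⟩, h _ _ ?_⟩
  refine (Exists.choose_spec (p := fun y => code y = _) _).trans ?_
  simp

instance (K : ℕ) : Finite (Label K) := by
  classical
  refine Finite.of_injective (fun (y : Label K) (k : Fin K) => decide (y.vec k = 0)) ?_
  intro y z h
  refine Subtype.ext (PiLp.ext fun k => ?_)
  have hk := congrFun h k
  simp only [Label.vec] at hk
  rcases y.2 k with h1 | h1 <;> rcases z.2 k with h2 | h2 <;> simp_all

theorem exists_input_code (d : ℕ) {r : ℝ} (hr : 0 < r) (L : ℕ) (k : InputKind) {ε : ℝ≥0∞}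
    (hε : ε ≠ 0) : ∃ (ι : Type) (_ : Finite ι) (code : Input d r L k → ι),
      ∀ x y, code x = code y → inputDist d r L k x y ≤ ε := by
  obtain ⟨n, j, q, hq, hc⟩ := (hasSmallCells_dIDM d hr L).exists_code hε
  refine ⟨Fin n → Fin (j + 1), inferInstance, ?_⟩
  cases k with
  | didm =>
    exact ⟨fun (μ : ProbabilityMeasure (IDM d r L)) i =>
      massCode j ((μ : Measure (IDM d r L)) (q ⁻¹' {i})),
      fun (μ ν : ProbabilityMeasure (IDM d r L)) h => hc _ _ (by simp) (by simp) (congrFun h)⟩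
  | graphonSignal =>
    exact ⟨fun (G : GraphonSignal d r) i => massCode j (G.compDIDM L (q ⁻¹' {i})),
      fun (G G' : GraphonSignal d r) h => hc _ _ (by simp) (by simp) (congrFun h)⟩

theorem exists_coveredBy_sampleDist (d : ℕ) {r : ℝ} (hr : 0 < r) (L : ℕ) (k : InputKind) (K : ℕ)
    {ε : ℝ} (hε : 0 < ε) : ∃ n, CoveredBy (sampleDist d r L k K) ε n := by
  -- Halving `ε` turns the non-strict bound into membership in an open ball.
  obtain ⟨ι, _, code, hcode⟩ := exists_input_code d hr L k (ε := ENNReal.ofReal (ε / 2))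
    (by simpa using hε)
  refine exists_coveredBy_of_code (fun a : Sample d r L k K => (code a.input, a.label)) ?_
  intro a b hab
  obtain ⟨h1, h2⟩ := Prod.ext_iff.1 hab
  simp only at h1 h2
  rw [sampleDist, h2, edist_self, add_zero]
  exact (hcode _ _ h1).trans_lt (ENNReal.ofReal_lt_ofReal_iff hε |>.2 (by linarith))

/-! ### Concentration of empirical frequencies -/

section Concentration

variable {S : Type*} [MeasurableSpace S]

/-- Hoeffding's inequality: a centered indicator is sub-Gaussian with variance proxy `1 / 4`. -/
theorem measure_empirical_sub_ge_le (τ : Measure S) [IsProbabilityMeasure τ] (N : ℕ)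
    {A : Set S} (hA : MeasurableSet A) {t : ℝ} (ht : 0 ≤ t) :
    (Measure.pi fun _ : Fin N => τ).real
      {X | N * t ≤ ∑ j, (A.indicator (fun _ => (1 : ℝ)) (X j) - τ.real A)} ≤
        Real.exp (-(2 * N * t ^ 2)) := by
  set Y : S → ℝ := fun a => A.indicator (fun _ => (1 : ℝ)) a - τ.real A
  have hind : Measurable fun a => A.indicator (fun _ => (1 : ℝ)) a := measurable_const.indicator hA
  have hY : Measurable Y := hind.sub_const _
  have hsub : ProbabilityTheory.HasSubgaussianMGF Y ((‖(1 : ℝ) - 0‖₊ / 2) ^ 2) τ := by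
    have := ProbabilityTheory.hasSubgaussianMGF_of_mem_Icc (μ := τ) (a := 0) (b := 1)
      hind.aemeasurable (ae_of_all _ fun a => by
        by_cases ha : a ∈ A <;> simp [ha])
    rwa [integral_indicator_const _ hA, smul_eq_mul, mul_one] at this
  have hindep : ProbabilityTheory.iIndepFun (fun (j : Fin N) (X : Fin N → S) => Y (X j))
      (Measure.pi fun _ : Fin N => τ) :=
    ProbabilityTheory.iIndepFun_pi (X := fun _ : Fin N => Y) fun _ => hY.aemeasurable
  have hsub' : ∀ j ∈ (Finset.univ : Finset (Fin N)), ProbabilityTheory.HasSubgaussianMGF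
      (fun X : Fin N → S => Y (X j)) ((‖(1 : ℝ) - 0‖₊ / 2) ^ 2)
      (Measure.pi fun _ : Fin N => τ) := fun j _ => by
    refine ProbabilityTheory.HasSubgaussianMGF.of_map (X := Y) (Y := fun X : Fin N → S => X j)
      (measurable_pi_apply j).aemeasurable ?_
    rwa [(measurePreserving_eval (fun _ : Fin N => τ) j).map_eq]
  refine (ProbabilityTheory.HasSubgaussianMGF.measure_sum_ge_le_of_iIndepFun hindep hsub'
    (mul_nonneg N.cast_nonneg ht)).trans (Real.exp_le_exp.2 (le_of_eq ?_))
  rcases Nat.eq_zero_or_pos N with rfl | hN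
  · simp
  · have : (N : ℝ) ≠ 0 := by positivity
    simp
    field_simp

/-- Union bound over the `2 ^ n` sets of cells: the condition on `t` says `2 ^ n * exp (-2 N t²) ≤
p`. One-sided deviations suffice, as complements give the other side. -/
theorem exists_event_frequencies {ι : Type*} [Fintype ι] [MeasurableSpace ι]
    [MeasurableSingletonClass ι] {q : S → ι} (hq : Measurable q) (τ : Measure S)
    [IsProbabilityMeasure τ] {N : ℕ} (hN : 1 ≤ N) {p : ℝ} (hp : 0 < p) {t : ℝ} (ht : 0 ≤ t)
    (htp : (Fintype.card ι - 1) * Real.log 2 + Real.log (2 / p) ≤ 2 * N * t ^ 2) :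
    ∃ U : Set (Fin N → S), MeasurableSet U ∧
      ENNReal.ofReal (1 - p) ≤ Measure.pi (fun _ : Fin N => τ) U ∧
      ∀ X ∈ U, ∀ A : Finset ι,
        (1 / (N : ℝ)) * ∑ j, (q ⁻¹' A).indicator (fun _ => (1 : ℝ)) (X j) - τ.real (q ⁻¹' A) ≤
          t := by
  have hN0 : (0 : ℝ) < N := by exact_mod_cast hN
  set P := Measure.pi fun _ : Fin N => τ
  have hqA : ∀ A : Finset ι, MeasurableSet (q ⁻¹' A) := fun A => hq A.measurableSet
  set bad : Finset ι → Set (Fin N → S) := fun A =>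
    {X | N * t ≤ ∑ j, ((q ⁻¹' A).indicator (fun _ => (1 : ℝ)) (X j) - τ.real (q ⁻¹' A))}
  have hbad : ∀ A, MeasurableSet (bad A) := fun A =>
    measurableSet_le measurable_const (Finset.measurable_sum _ fun j _ =>
      ((measurable_const.indicator (hqA A)).comp (measurable_pi_apply j)).sub_const _)
  have hprob : P.real (⋃ A, bad A) ≤ p := by
    calc P.real (⋃ A, bad A) ≤ ∑ A, P.real (bad A) := measureReal_iUnion_fintype_le _
      _ ≤ ∑ _A : Finset ι, Real.exp (-(2 * N * t ^ 2)) :=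
          Finset.sum_le_sum fun A _ => measure_empirical_sub_ge_le τ N (hqA A) ht
      _ = 2 ^ Fintype.card ι * Real.exp (-(2 * N * t ^ 2)) := by simp
      _ ≤ 2 ^ Fintype.card ι *
            Real.exp (-((Fintype.card ι - 1) * Real.log 2 + Real.log (2 / p))) := by
          gcongr
      _ = p := by
          have h2 : (2 : ℝ) ^ Fintype.card ι = Real.exp (Fintype.card ι * Real.log 2) := by
            rw [← Real.log_pow, Real.exp_log (by positivity)]
          rw [h2, ← Real.exp_add, Real.log_div two_ne_zero hp.ne']
          rw [show Fintype.card ι * Real.log 2 +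
            -((Fintype.card ι - 1) * Real.log 2 + (Real.log 2 - Real.log p)) = Real.log p by ring,
            Real.exp_log hp]
  refine ⟨(⋃ A, bad A)ᶜ, (MeasurableSet.iUnion hbad).compl, ?_, fun X hX A => ?_⟩
  · rw [prob_compl_eq_one_sub (MeasurableSet.iUnion hbad), ENNReal.ofReal_sub _ hp.le,
      ENNReal.ofReal_one]
    refine tsub_le_tsub_left ?_ _
    rw [← ofReal_measureReal]
    exact ENNReal.ofReal_le_ofReal hprob
  · have h1 : X ∉ bad A := fun h => hX (Set.mem_iUnion.2 ⟨A, h⟩)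
    have h2 : ∑ j, ((q ⁻¹' A).indicator (fun _ => (1 : ℝ)) (X j) - τ.real (q ⁻¹' A)) < N * t :=
      not_le.1 h1
    rw [Finset.sum_sub_distrib, Finset.sum_const, Finset.card_univ, Fintype.card_fin,
      nsmul_eq_mul] at h2
    rw [one_div, sub_le_iff_le_add, inv_mul_le_iff₀ hN0]
    linarith

/-- Since `∑ a = 0`, subtracting the minimum of `g` is free, so only the oscillation of `g` counts.
The positive and negative parts of `a` have equal sums, each at most `t`. -/
theorem abs_sum_mul_le_of_sum_eq_zero {ι : Type*} [Fintype ι] [Nonempty ι] {a g : ι → ℝ}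
    {t w : ℝ} (ha : ∑ i, a i = 0) (hA : ∀ A : Finset ι, ∑ i ∈ A, -a i ≤ t)
    (hw : ∀ i j, g i - g j ≤ w) : |∑ i, g i * a i| ≤ w * t := by
  obtain ⟨i₀, hi₀⟩ := Finite.exists_min g
  have hw0 : 0 ≤ w := by simpa using hw i₀ i₀
  have hshift : ∑ i, g i * a i = ∑ i, (g i - g i₀) * a i := by
    simp only [sub_mul, Finset.sum_sub_distrib, ← Finset.mul_sum, ha, mul_zero, sub_zero]
  have hneg : ∑ i, max (-a i) 0 ≤ t := by
    classical
    have : ∑ i, max (-a i) 0 = ∑ i with a i < 0, -a i := by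
      rw [Finset.sum_filter]
      refine Finset.sum_congr rfl fun i _ => ?_
      split_ifs with h
      · exact max_eq_left (by linarith)
      · exact max_eq_right (by linarith)
    rw [this]
    exact hA _
  have hpos : ∑ i, max (a i) 0 ≤ t := by
    have : ∑ i, max (a i) 0 = ∑ i, max (-a i) 0 + ∑ i, a i := by
      rw [← Finset.sum_add_distrib]
      refine Finset.sum_congr rfl fun i _ => ?_
      rcases le_total 0 (a i) with h | h
      · rw [max_eq_left h, max_eq_right (by linarith), zero_add]
      · rw [max_eq_right h, max_eq_left (by linarith), neg_add_cancel]
    rw [this, ha, add_zero]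
    exact hneg
  have hterm : ∀ (b : ι → ℝ), ∑ i, max (b i) 0 ≤ t → ∑ i, (g i - g i₀) * b i ≤ w * t := by
    intro b hb
    calc ∑ i, (g i - g i₀) * b i ≤ ∑ i, w * max (b i) 0 := Finset.sum_le_sum fun i _ => by
          calc (g i - g i₀) * b i ≤ (g i - g i₀) * max (b i) 0 :=
                mul_le_mul_of_nonneg_left (le_max_left _ _) (sub_nonneg.2 (hi₀ i))
            _ ≤ w * max (b i) 0 := mul_le_mul_of_nonneg_right (hw i i₀) (le_max_right _ _)
      _ = w * ∑ i, max (b i) 0 := (Finset.mul_sum ..).symm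
      _ ≤ w * t := mul_le_mul_of_nonneg_left hb hw0
  rw [hshift, abs_le]
  refine ⟨?_, hterm a hpos⟩
  have := hterm (fun i => -a i) hneg
  simp only [mul_neg, Finset.sum_neg_distrib] at this
  linarith

/-- Replacing `F` by the step function `g ∘ q` costs `δ` in the integral and `δ` in the mean; the
rest is a sum against the differences between cell probabilities and frequencies. -/
theorem abs_integral_sub_mean_le {ι : Type*} [Fintype ι] [MeasurableSpace ι]
    [MeasurableSingletonClass ι] {q : S → ι} (hq : Measurable q) (τ : Measure S)
    [IsProbabilityMeasure τ] {N : ℕ} (hN : 1 ≤ N) {X : Fin N → S} {t w δ : ℝ}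
    (hX : ∀ A : Finset ι,
      (1 / (N : ℝ)) * ∑ j, (q ⁻¹' A).indicator (fun _ => (1 : ℝ)) (X j) - τ.real (q ⁻¹' A) ≤ t)
    {F : S → ℝ} (hF : Measurable F) {g : ι → ℝ} (hδ : ∀ a, |F a - g (q a)| ≤ δ)
    (hw : ∀ i j, g i - g j ≤ w) :
    |∫ a, F a ∂τ - (1 / (N : ℝ)) * ∑ j, F (X j)| ≤ 2 * δ + w * t := by
  classical
  have hN0 : (0 : ℝ) < N := by exact_mod_cast hN
  have hqi : ∀ i, MeasurableSet (q ⁻¹' {i}) := fun i => hq (measurableSet_singleton i)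
  obtain ⟨a₀⟩ : Nonempty S := by
    by_contra h
    rw [not_nonempty_iff] at h
    exact IsProbabilityMeasure.ne_zero τ (Subsingleton.elim _ _)
  have : Nonempty ι := ⟨q a₀⟩
  have hgq : Measurable fun a => g (q a) := (measurable_of_finite g).comp hq
  obtain ⟨M, hM⟩ : ∃ M, ∀ i, |g i| ≤ M := by
    obtain ⟨i, hi⟩ := Finite.exists_max fun i => |g i|
    exact ⟨_, hi⟩
  have hgint : Integrable (fun a => g (q a)) τ :=
    .of_bound hgq.aestronglyMeasurable M (ae_of_all _ fun a => hM _)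
  have hdint : Integrable (fun a => F a - g (q a)) τ :=
    .of_bound (hF.sub hgq).aestronglyMeasurable δ (ae_of_all _ hδ)
  have hFint : Integrable F τ :=
    (hdint.add hgint).congr (ae_of_all _ fun a => sub_add_cancel (F a) (g (q a)))
  have h1 : |∫ a, F a ∂τ - ∫ a, g (q a) ∂τ| ≤ δ := by
    rw [← integral_sub hFint hgint, ← Real.norm_eq_abs]
    simpa using norm_integral_le_of_norm_le_const (μ := τ) (f := fun a => F a - g (q a))
      (ae_of_all _ hδ)
  have h2 : |(1 / (N : ℝ)) * ∑ j, F (X j) - (1 / (N : ℝ)) * ∑ j, g (q (X j))| ≤ δ := by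
    rw [← mul_sub, ← Finset.sum_sub_distrib, abs_mul, abs_of_pos (by positivity), one_div,
      inv_mul_le_iff₀ hN0]
    refine (Finset.abs_sum_le_sum_abs _ _).trans ((Finset.sum_le_sum fun j _ => hδ (X j)).trans ?_)
    simp
  set f : ι → ℝ := fun i => (1 / (N : ℝ)) * ∑ j, (q ⁻¹' {i}).indicator (fun _ => (1 : ℝ)) (X j)
  have hsumind : ∀ (A : Finset ι) (x : S), ∑ i ∈ A, (q ⁻¹' {i}).indicator (fun _ => (1 : ℝ)) x =
      (q ⁻¹' A).indicator (fun _ => (1 : ℝ)) x := by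
    intro A x
    simp [Set.indicator_apply, Finset.sum_ite_eq]
  have hfA : ∀ A : Finset ι, ∑ i ∈ A, f i =
      (1 / (N : ℝ)) * ∑ j, (q ⁻¹' A).indicator (fun _ => (1 : ℝ)) (X j) := by
    intro A
    simp only [f]
    rw [← Finset.mul_sum, Finset.sum_comm]
    simp only [hsumind]
  have hτA : ∀ A : Finset ι, ∑ i ∈ A, τ.real (q ⁻¹' {i}) = τ.real (q ⁻¹' A) := by
    intro A
    simp only [measureReal_def]
    rw [← ENNReal.toReal_sum fun i _ => measure_ne_top _ _,
      sum_measure_preimage_singleton _ fun i _ => hqi i]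
  have hgeq : ∀ x, g (q x) = ∑ i, g i * (q ⁻¹' {i}).indicator (fun _ => (1 : ℝ)) x := by
    intro x
    simp [Set.indicator_apply]
  have h3 : ∫ a, g (q a) ∂τ = ∑ i, g i * τ.real (q ⁻¹' {i}) := by
    simp only [hgeq]
    rw [integral_finsetSum _ fun i _ => ((integrable_const (1 : ℝ)).indicator (hqi i)).const_mul _]
    refine Finset.sum_congr rfl fun i _ => ?_
    rw [integral_const_mul, integral_indicator_const _ (hqi i), smul_eq_mul, mul_one]
  have h4 : (1 / (N : ℝ)) * ∑ j, g (q (X j)) = ∑ i, g i * f i := by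
    simp only [hgeq, f]
    rw [Finset.sum_comm, Finset.mul_sum]
    refine Finset.sum_congr rfl fun i _ => ?_
    rw [← Finset.mul_sum]
    ring
  have h5 : |∑ i, g i * (τ.real (q ⁻¹' {i}) - f i)| ≤ w * t := by
    refine abs_sum_mul_le_of_sum_eq_zero ?_ (fun A => ?_) hw
    · rw [Finset.sum_sub_distrib, hτA, hfA]
      simp [hN0.ne']
    · simp only [neg_sub]
      rw [Finset.sum_sub_distrib, hτA, hfA]
      exact hX A
  simp only [mul_sub, Finset.sum_sub_distrib, ← h3, ← h4] at h5
  rw [abs_le] at h1 h2 h5 ⊢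
  constructor <;> linarith [h1.1, h1.2, h2.1, h2.2, h5.1, h5.2]

end Concentration

/-! ### Covering the cube -/

section Cube

variable {K : ℕ}

/-- The label with entry `1` exactly on `T`. -/
def Label.indicator (T : Finset (Fin K)) : Label K :=
  ⟨WithLp.toLp 2 fun k => if k ∈ T then 1 else 0, fun k => by
    by_cases h : k ∈ T <;> simp [h]⟩

theorem Label.norm_sub_sq (y z : Label K) :
    ‖y.vec - z.vec‖ ^ 2 = ((Finset.univ.filter fun k => y.vec k ≠ z.vec k).card : ℝ) := by
  rw [EuclideanSpace.norm_sq_eq, Finset.card_filter, Nat.cast_sum]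
  refine Finset.sum_congr rfl fun k _ => ?_
  rcases y.2 k with h1 | h1 <;> rcases z.2 k with h2 | h2 <;>
    simp [Label.vec, h1, h2]

theorem Label.norm_sub_le (y z : Label K) : ‖y.vec - z.vec‖ ≤ Real.sqrt K := by
  refine Real.le_sqrt_of_sq_le ?_
  rw [Label.norm_sub_sq]
  exact_mod_cast (Finset.card_filter_le _ _).trans (by simp)

/-- The right side is the mean over independent random signs. Fixing the signs one at a time, each
making its cross term nonpositive, attains it. -/
theorem exists_signs_sum_sq_le {ι κ : Type*} [Fintype ι] (s : ι → κ → ℝ)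
    (hs : ∀ i k, s i k ^ 2 = 1) (T : Finset κ) :
    ∃ e : κ → ℝ, (∀ k, e k = 1 ∨ e k = -1) ∧
      ∑ i, (∑ k ∈ T, e k * s i k) ^ 2 ≤ Fintype.card ι * T.card := by
  classical
  induction T using Finset.induction_on with
  | empty => exact ⟨fun _ => 1, fun _ => Or.inl rfl, by simp⟩
  | insert k T hk ih =>
    obtain ⟨e, he, hle⟩ := ih
    obtain ⟨b, hb, hcross⟩ : ∃ b : ℝ, (b = 1 ∨ b = -1) ∧
        b * ∑ i, s i k * ∑ l ∈ T, e l * s i l ≤ 0 := by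
      rcases le_total 0 (∑ i, s i k * ∑ l ∈ T, e l * s i l) with h | h
      · exact ⟨-1, Or.inr rfl, by linarith⟩
      · exact ⟨1, Or.inl rfl, by linarith⟩
    refine ⟨Function.update e k b, fun l => ?_, ?_⟩
    · by_cases hl : l = k
      · subst hl
        simpa using hb
      · simpa [hl] using he l
    · have hb2 : b ^ 2 = 1 := by rcases hb with rfl | rfl <;> norm_num
      have hsum : ∀ i, ∑ l ∈ insert k T, Function.update e k b l * s i l =
          b * s i k + ∑ l ∈ T, e l * s i l := by
        intro i
        rw [Finset.sum_insert hk, Function.update_self]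
        congr 1
        refine Finset.sum_congr rfl fun l hl => ?_
        rw [Function.update_of_ne (by rintro rfl; exact hk hl)]
      have hsq : ∀ i, (b * s i k + ∑ l ∈ T, e l * s i l) ^ 2 =
          1 + 2 * (b * (s i k * ∑ l ∈ T, e l * s i l)) + (∑ l ∈ T, e l * s i l) ^ 2 := by
        intro i
        have : (b * s i k) ^ 2 = 1 := by rw [mul_pow, hb2, hs, one_mul]
        linear_combination this
      simp only [hsum, hsq, Finset.sum_add_distrib, ← Finset.mul_sum, Finset.sum_const,
        Finset.card_univ, Finset.card_insert_of_notMem hk]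
      push_cast
      simp only [nsmul_eq_mul, mul_one]
      linarith

/-- Few balls covering the cube must be large. In ±1 coordinates a center at Hamming distance `h`
from `y` has inner product `K - 2h` with it; balanced signs give a `y` nearly orthogonal to all
centers, so the one whose ball contains `y` has `h` near `K / 2`, and `h` is the squared Euclidean
distance. -/
theorem exists_hamming_of_cover {n : ℕ} {ε : ℝ} (c : Fin n → Label K)
    (hc : ∀ y : Label K, ∃ i, ‖(c i).vec - y.vec‖ < ε) :
    ∃ h : ℕ, ((K : ℝ) - 2 * h) ^ 2 ≤ n * K ∧ (h : ℝ) < ε ^ 2 := by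
  classical
  have hsq : ∀ (y : Label K) k, (2 * y.vec k - 1) ^ 2 = 1 := by
    intro y k
    rcases y.2 k with h | h <;> simp only [Label.vec, h] <;> norm_num
  obtain ⟨e, he, hle⟩ := exists_signs_sum_sq_le (fun i k => 2 * (c i).vec k - 1)
    (fun i k => hsq (c i) k) Finset.univ
  set y : Label K := Label.indicator (Finset.univ.filter fun k => e k = 1)
  have hy : ∀ k, e k = 2 * y.vec k - 1 := by
    intro k
    rcases he k with h | h
    · simp [y, Label.indicator, Label.vec, h]
      norm_num
    · have : ¬ ((-1 : ℝ) = 1) := by norm_num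
      simp [y, Label.indicator, Label.vec, h, this]
  obtain ⟨i, hi⟩ := hc y
  refine ⟨(Finset.univ.filter fun k => (c i).vec k ≠ y.vec k).card, ?_, ?_⟩
  · have hin : ∑ k, e k * (2 * (c i).vec k - 1) = K - 2 * ‖(c i).vec - y.vec‖ ^ 2 := by
      rw [EuclideanSpace.norm_sq_eq, Finset.mul_sum]
      have hK : (K : ℝ) = ∑ _k : Fin K, (1 : ℝ) := by simp
      rw [hK, ← Finset.sum_sub_distrib]
      refine Finset.sum_congr rfl fun k _ => ?_
      rw [hy, Real.norm_eq_abs, sq_abs, PiLp.sub_apply]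
      linear_combination (1 / 2) * hsq (c i) k + (1 / 2) * hsq y k
    rw [← Label.norm_sub_sq, ← hin]
    refine (Finset.single_le_sum (f := fun i => (∑ k, e k * (2 * (c i).vec k - 1)) ^ 2)
      (fun i _ => sq_nonneg _) (Finset.mem_univ i)).trans (hle.trans ?_)
    simp
  · rw [← Label.norm_sub_sq]
    exact pow_lt_pow_left₀ hi (norm_nonneg _) two_ne_zero

/-- The label opposite to the first center on half of the coordinates and to the second on the
others is far from both. -/
theorem half_lt_sq_of_cover_two {ε : ℝ} (c : Fin 2 → Label K)
    (hc : ∀ y : Label K, ∃ i, ‖(c i).vec - y.vec‖ < ε) : ((K / 2 : ℕ) : ℝ) < ε ^ 2 := by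
  classical
  obtain ⟨T, -, hT⟩ := Finset.exists_subset_card_eq (s := (Finset.univ : Finset (Fin K)))
    (n := K / 2) (by simpa using Nat.div_le_self K 2)
  have hTc : K / 2 ≤ Tᶜ.card := by
    rw [Finset.card_compl, hT, Fintype.card_fin]
    omega
  set y : Label K := Label.indicator (Finset.univ.filter fun k =>
    (k ∈ T ∧ (c 0).vec k = 0) ∨ (k ∉ T ∧ (c 1).vec k = 0))
  have hy : ∀ k, y.vec k = if (k ∈ T ∧ (c 0).vec k = 0) ∨ (k ∉ T ∧ (c 1).vec k = 0) then 1
      else 0 := by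
    intro k
    exact if_congr (by rw [Finset.mem_filter]; simp) rfl rfl
  obtain ⟨i, hi⟩ := hc y
  have h1 : ‖(c i).vec - y.vec‖ ^ 2 < ε ^ 2 := pow_lt_pow_left₀ hi (norm_nonneg _) two_ne_zero
  refine lt_of_le_of_lt ?_ h1
  rw [Label.norm_sub_sq]
  norm_cast
  fin_cases i
  · rw [← hT]
    refine Finset.card_le_card fun k hk => ?_
    rw [Finset.mem_filter, hy]
    rcases (c 0).2 k with h | h <;> simp [hk, Label.vec, h]
  · refine hTc.trans (Finset.card_le_card fun k hk => ?_)
    rw [Finset.mem_compl] at hk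
    rw [Finset.mem_filter, hy]
    rcases (c 1).2 k with h | h <;> simp [hk, Label.vec, h]

end Cube

/-! ### The loss along a Lipschitz hypothesis -/

section Loss

variable {d L K m : ℕ} {r : ℝ} {k : InputKind} {loss : Vec m → Label K → ℝ} {Closs CΘ BΘ : ℝ}
  {M : Input d r L k → Vec m}

theorem abs_loss_sub_le_of_sampleDist_lt (hC : 0 ≤ Closs) (hloss : LossLipschitz Closs loss)
    (hM : M ∈ LipClass (inputDist d r L k) m CΘ BΘ) {a b : Sample d r L k K} {ε : ℝ} (hε : 0 < ε)
    (hab : sampleDist d r L k K a b < ENNReal.ofReal ε) :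
    |loss (M a.input) a.label - loss (M b.input) b.label| ≤ Closs * max CΘ 1 * ε := by
  refine (hloss _ _ _ _).trans ?_
  rw [mul_assoc]
  refine mul_le_mul_of_nonneg_left ?_ hC
  have hi : inputDist d r L k a.input b.input ≠ ⊤ :=
    ((le_self_add.trans_lt hab).trans_le le_top).ne
  set e := inputDist d r L k a.input b.input with he
  have h1 : ‖M a.input - M b.input‖ ≤ max CΘ 1 * e.toReal := by
    have h2 := hM.1 a.input b.input
    rw [edist_dist, ← he, ← ENNReal.ofReal_toReal hi,
      ← ENNReal.ofReal_mul' ENNReal.toReal_nonneg, dist_eq_norm] at h2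
    rcases le_or_gt 0 (CΘ * e.toReal) with h0 | h0
    · refine ((ENNReal.ofReal_le_ofReal_iff h0).1 h2).trans ?_
      exact mul_le_mul_of_nonneg_right (le_max_left _ _) ENNReal.toReal_nonneg
    · rw [ENNReal.ofReal_of_nonpos h0.le, nonpos_iff_eq_zero, ENNReal.ofReal_eq_zero] at h2
      exact h2.trans (by positivity)
  have h3 : e.toReal + ‖a.label.vec - b.label.vec‖ < ε := by
    rw [sampleDist, ← he, ← ENNReal.ofReal_toReal hi, edist_dist,
      ← ENNReal.ofReal_add ENNReal.toReal_nonneg dist_nonneg, dist_eq_norm] at hab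
    exact (ENNReal.ofReal_lt_ofReal_iff hε).1 hab
  have h4 : ‖a.label.vec - b.label.vec‖ ≤ max CΘ 1 * ‖a.label.vec - b.label.vec‖ :=
    le_mul_of_one_le_left (norm_nonneg _) (le_max_right _ _)
  have h5 : (0 : ℝ) < max CΘ 1 := lt_max_of_lt_right one_pos
  nlinarith

theorem abs_loss_sub_le (hC : 0 ≤ Closs) (hloss : LossLipschitz Closs loss)
    (hM : M ∈ LipClass (inputDist d r L k) m CΘ BΘ) (a b : Sample d r L k K) :
    |loss (M a.input) a.label - loss (M b.input) b.label| ≤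
      Closs * (2 * BΘ + Real.sqrt K) := by
  refine (hloss _ _ _ _).trans (mul_le_mul_of_nonneg_left (add_le_add ?_ ?_) hC)
  · linarith [norm_sub_le (M a.input) (M b.input), hM.2 a.input, hM.2 b.input]
  · exact Label.norm_sub_le _ _

theorem measurableSet_ball_sampleDist (a : Sample d r L k K) (ε : ℝ) :
    MeasurableSet {b | sampleDist d r L k K a b < ENNReal.ofReal ε} :=
  MeasurableSpace.measurableSet_generateFrom
    (TopologicalSpace.isOpen_generateFrom_of_mem ⟨a, ε, rfl⟩)

theorem sampleDist_self (a : Sample d r L k K) : sampleDist d r L k K a a = 0 := by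
  rw [sampleDist, inputDist_self, edist_self, add_zero]

/-- Superlevel sets are open: around each point they contain a ball, which is open by definition of
the topology, so no triangle inequality is required. -/
theorem measurable_loss (hC : 0 ≤ Closs) (hloss : LossLipschitz Closs loss)
    (hM : M ∈ LipClass (inputDist d r L k) m CΘ BΘ) :
    Measurable fun a : Sample d r L k K => loss (M a.input) a.label := by
  refine measurable_of_Ioi fun t => MeasurableSpace.measurableSet_generateFrom ?_
  refine (@isOpen_iff_forall_mem_open _ (ballTopology (sampleDist d r L k K)) _).2 fun a ha => ?_
  have ha' : t < loss (M a.input) a.label := ha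
  set C := Closs * max CΘ 1
  have hC0 : 0 ≤ C := mul_nonneg hC (le_max_of_le_right zero_le_one)
  -- The `+ 1` keeps the denominator positive when the Lipschitz constant is zero.
  set δ := (loss (M a.input) a.label - t) / (C + 1)
  have hδ : 0 < δ := div_pos (sub_pos.2 ha') (by positivity)
  refine ⟨{b | sampleDist d r L k K a b < ENNReal.ofReal δ}, fun b hb => ?_,
    TopologicalSpace.isOpen_generateFrom_of_mem ⟨a, δ, rfl⟩, ?_⟩
  · have h1 := abs_loss_sub_le_of_sampleDist_lt hC hloss hM hδ hb
    have h2 : (C + 1) * δ = loss (M a.input) a.label - t := mul_div_cancel₀ _ (by positivity)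
    have h3 := (abs_le.1 h1).2
    change t < loss (M b.input) b.label
    change _ ≤ C * δ at h3
    nlinarith
  · change sampleDist d r L k K a a < _
    rw [sampleDist_self]
    exact ENNReal.ofReal_pos.2 hδ

/-- Each point is sent to the least index of a ball containing it. -/
theorem exists_measurable_selection {n : ℕ} {ε : ℝ} (c : Fin n → Sample d r L k K)
    (hc : ∀ a, ∃ i, sampleDist d r L k K (c i) a < ENNReal.ofReal ε) :
    ∃ q : Sample d r L k K → Fin n, Measurable q ∧
      ∀ a, sampleDist d r L k K (c (q a)) a < ENNReal.ofReal ε := by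
  classical
  set P : Sample d r L k K → ℕ → Prop := fun a j =>
    ∃ h : j < n, sampleDist d r L k K (c ⟨j, h⟩) a < ENNReal.ofReal ε
  have hP : ∀ a, ∃ j, P a j := fun a => by
    obtain ⟨i, hi⟩ := hc a
    exact ⟨i, i.2, hi⟩
  have hm : Measurable fun a => Nat.find (hP a) := by
    refine measurable_find hP fun j => ?_
    by_cases hj : j < n
    · simpa [P, hj] using measurableSet_ball_sampleDist (c ⟨j, hj⟩) ε
    · simp [P, hj]
  refine ⟨fun a => ⟨Nat.find (hP a), (Nat.find_spec (hP a)).1⟩, ?_,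
    fun a => (Nat.find_spec (hP a)).2⟩
  refine measurable_to_countable' fun i => ?_
  convert! hm (measurableSet_singleton (i : ℕ)) using 1
  ext a
  simp [Fin.ext_iff]

theorem exists_event_of_cover {n : ℕ} {ε : ℝ} (hε : 0 < ε) (c : Fin n → Sample d r L k K)
    (hc : ∀ a, ∃ i, sampleDist d r L k K (c i) a < ENNReal.ofReal ε)
    (hC : 0 ≤ Closs) (hloss : LossLipschitz Closs loss)
    (τ : Measure (Sample d r L k K)) [IsProbabilityMeasure τ] {N : ℕ} (hN : 1 ≤ N) {p : ℝ}
    (hp : 0 < p) {t w : ℝ} (ht : 0 ≤ t)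
    (htp : ((n : ℝ) - 1) * Real.log 2 + Real.log (2 / p) ≤ 2 * N * t ^ 2)
    (hw : ∀ M ∈ LipClass (inputDist d r L k) m CΘ BΘ, ∀ i j,
      loss (M (c i).input) (c i).label - loss (M (c j).input) (c j).label ≤ w) :
    ∃ U : Set (Fin N → Sample d r L k K), MeasurableSet U ∧
      ENNReal.ofReal (1 - p) ≤ Measure.pi (fun _ : Fin N => τ) U ∧
      ∀ X ∈ U, ∀ M ∈ LipClass (inputDist d r L k) m CΘ BΘ,
        |risk loss τ M - empiricalRisk loss X M| ≤ 2 * (Closs * max CΘ 1 * ε) + w * t := by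
  obtain ⟨q, hq, hqc⟩ := exists_measurable_selection c hc
  obtain ⟨U, hU, hUp, hUA⟩ := exists_event_frequencies hq τ hN hp ht (by simpa using htp)
  refine ⟨U, hU, hUp, fun X hX M hM => ?_⟩
  refine abs_integral_sub_mean_le hq τ hN (hUA X hX) (measurable_loss hC hloss hM)
    (g := fun i => loss (M (c i).input) (c i).label) (fun a => ?_) (hw M hM)
  rw [abs_sub_comm]
  exact abs_loss_sub_le_of_sampleDist_lt hC hloss hM hε (hqc a)

theorem abs_risk_sub_empiricalRisk_le (hC : 0 ≤ Closs) (hloss : LossLipschitz Closs loss)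
    (hM : M ∈ LipClass (inputDist d r L k) m CΘ BΘ)
    (τ : Measure (Sample d r L k K)) [IsProbabilityMeasure τ] {N : ℕ} (hN : 1 ≤ N) {R : ℝ}
    (hR : ∀ a b : Sample d r L k K,
      |loss (M a.input) a.label - loss (M b.input) b.label| ≤ R)
    (X : Fin N → Sample d r L k K) : |risk loss τ M - empiricalRisk loss X M| ≤ R := by
  have hN0 : (0 : ℝ) < N := by exact_mod_cast hN
  set F : Sample d r L k K → ℝ := fun a => loss (M a.input) a.label
  have hF : Measurable F := measurable_loss hC hloss hM
  have hint : Integrable F τ := by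
    refine .of_bound hF.aestronglyMeasurable (|F (X ⟨0, hN⟩)| + R) (ae_of_all _ fun a => ?_)
    have h1 := abs_add_le (F (X ⟨0, hN⟩)) (F a - F (X ⟨0, hN⟩))
    rw [add_sub_cancel] at h1
    exact h1.trans (add_le_add_right (hR a (X ⟨0, hN⟩)) _)
  have hj : ∀ j, |∫ a, F a ∂τ - F (X j)| ≤ R := fun j => by
    have h1 : ∫ a, F a ∂τ - F (X j) = ∫ a, (F a - F (X j)) ∂τ := by
      rw [integral_sub hint (integrable_const _)]
      simp
    rw [h1, ← Real.norm_eq_abs]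
    simpa using norm_integral_le_of_norm_le_const (μ := τ) (f := fun a => F a - F (X j))
      (ae_of_all _ fun a => hR a (X j))
  have h2 : risk loss τ M - empiricalRisk loss X M =
      (1 / (N : ℝ)) * ∑ j, (∫ a, F a ∂τ - F (X j)) := by
    rw [Finset.sum_sub_distrib]
    simp only [Finset.sum_const, Finset.card_univ, Fintype.card_fin, nsmul_eq_mul, mul_sub,
      risk, empiricalRisk, F]
    field_simp
  rw [h2, abs_mul, abs_of_pos (by positivity), one_div, inv_mul_le_iff₀ hN0]
  refine (Finset.abs_sum_le_sum_abs _ _).trans ((Finset.sum_le_sum fun j _ => hj j).trans ?_)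
  simp

end Loss

/-! ### Numerical estimates -/

/-- With `P = n² log n`, the condition `ξ(ε) ≤ N` reads `P / ε² ≤ N`; inserting this lower bound for
`N` leaves an inequality in which neither `ε` nor `N` appears. -/
theorem mul_sqrt_div_le {a n ℓ ε N P : ℝ} (ha : 0 ≤ a) (hε : 0 < ε) (hN : 0 < N)
    (hP : P / ε ^ 2 ≤ N) (h : a ^ 2 * ((n - 1) * Real.log 2 + ℓ) ≤ P * (1 + Real.sqrt ℓ) ^ 2)
    (h0 : 0 ≤ (n - 1) * Real.log 2 + ℓ) :
    a * Real.sqrt (((n - 1) * Real.log 2 + ℓ) / (2 * N)) ≤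
      ε * (1 + Real.sqrt ℓ) / Real.sqrt 2 := by
  refine (pow_le_pow_iff_left₀ (by positivity) (by positivity) two_ne_zero).1 ?_
  rw [mul_pow, Real.sq_sqrt (by positivity), div_pow, mul_pow, Real.sq_sqrt (by norm_num),
    mul_div_assoc', div_le_div_iff₀ (by positivity) (by norm_num)]
  rw [div_le_iff₀ (by positivity)] at hP
  have := mul_le_mul_of_nonneg_right hP (sq_nonneg (1 + Real.sqrt ℓ))
  nlinarith

/-! ### The generalization bound at a fixed scale -/

section Scale

/-- Here and below `s` stands for `√(log (2 / p))`, and the inequalities are those required by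
`mul_sqrt_div_le`. For two balls `n² log n = 4 log 2 > 1`, so coefficient one works for every `s`.
-/
theorem one_mul_log_two_add_sq_le {s : ℝ} (hs : 0 ≤ s) :
    (1 : ℝ) ^ 2 * ((2 - 1) * Real.log 2 + s ^ 2) ≤ 2 ^ 2 * Real.log 2 * (1 + s) ^ 2 := by
  have hl := Real.log_two_gt_d9
  have h : 0.69 * (s ^ 2 + 2 * s) ≤ Real.log 2 * (s ^ 2 + 2 * s) := by
    gcongr
    linarith
  nlinarith

/-- As `4 log 2 < 4`, this fails for large `s`, that is for small `p`; the upper bound on `s` is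
essential. -/
theorem four_mul_log_two_add_sq_le {s : ℝ} (hs : 0.83 ≤ s) (hs' : s ≤ 1.8286) :
    (2 : ℝ) ^ 2 * ((2 - 1) * Real.log 2 + s ^ 2) ≤ 2 ^ 2 * Real.log 2 * (1 + s) ^ 2 := by
  have hl := Real.log_two_gt_d9
  have h : 0.69 * (s ^ 2 + 2 * s) ≤ Real.log 2 * (s ^ 2 + 2 * s) := by
    gcongr
    linarith
  nlinarith

theorem five_mul_log_two_add_sq_le {s : ℝ} (hs : 0.83 ≤ s) (hs' : s ≤ 1.8286) :
    (5 : ℝ) * ((2 - 1) * Real.log 2 + s ^ 2) ≤ 2 ^ 2 * Real.log 2 * (1 + s) ^ 2 := by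
  have hl := Real.log_two_gt_d9
  have h : 0.693 * (4 * s ^ 2 + 8 * s - 1) ≤ Real.log 2 * (4 * s ^ 2 + 8 * s - 1) := by
    gcongr
    · nlinarith
    · linarith
  -- With `log 2` replaced by `0.693` the difference of the two sides is concave in `s`, so the
  -- endpoints decide.
  nlinarith [mul_nonneg (sub_nonneg.2 hs) (sub_nonneg.2 hs')]

variable {d L K m : ℕ} {r : ℝ} {k : InputKind} {loss : Vec m → Label K → ℝ} {Closs CΘ BΘ : ℝ}

theorem one_le_log_of_three_le {n : ℝ} (hn : 3 ≤ n) : 1 ≤ Real.log n := by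
  rw [Real.le_log_iff_exp_le (by linarith)]
  linarith [Real.exp_one_lt_d9]

theorem sq_mul_le_sq_mul_log_mul {n : ℝ} (hn : 3 ≤ n) (s : ℝ) :
    n ^ 2 * (1 + s) ^ 2 ≤ n ^ 2 * Real.log n * (1 + s) ^ 2 := by
  have : n ^ 2 ≤ n ^ 2 * Real.log n :=
    le_mul_of_one_le_right (by positivity) (one_le_log_of_three_le hn)
  gcongr

theorem four_mul_card_log_two_add_sq_le {n s : ℝ} (hn : 3 ≤ n) (hs : 0.83 ≤ s) :
    2 ^ 2 * ((n - 1) * Real.log 2 + s ^ 2) ≤ n ^ 2 * Real.log n * (1 + s) ^ 2 := by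
  refine le_trans ?_ (sq_mul_le_sq_mul_log_mul hn s)
  have h1 : (n - 1) * Real.log 2 ≤ (n - 1) * 1 :=
    mul_le_mul_of_nonneg_left (by linarith [Real.log_two_lt_d9]) (by linarith)
  have h2 : 4 * s ^ 2 ≤ n ^ 2 * s ^ 2 := by
    gcongr
    nlinarith
  have h3 : 0 ≤ n ^ 2 * s := by positivity
  nlinarith [sq_nonneg (n - 2)]

/-- As `log n ≥ 1`, it suffices that `3n (0.7 n + s²) ≤ n² (2.1 + s²) ≤ n² (1 + s)²`; the first step
uses `n ≥ 3`, the second `2s ≥ 1.66`. -/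
theorem dim_mul_card_log_two_add_sq_le {n s K : ℝ} (hn : 3 ≤ n) (hs : 0.83 ≤ s)
    (hK : K ≤ 3 * n) :
    K * ((n - 1) * Real.log 2 + s ^ 2) ≤ n ^ 2 * Real.log n * (1 + s) ^ 2 := by
  refine le_trans ?_ (sq_mul_le_sq_mul_log_mul hn s)
  have h0 : 0 < Real.log 2 := Real.log_pos one_lt_two
  have h1 : (n - 1) * Real.log 2 ≤ n * 0.7 :=
    mul_le_mul (by linarith) (by linarith [Real.log_two_lt_d9]) h0.le (by linarith)
  have hQ : 0 ≤ (n - 1) * Real.log 2 + s ^ 2 :=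
    add_nonneg (mul_nonneg (by linarith) h0.le) (sq_nonneg s)
  have h2 : K * ((n - 1) * Real.log 2 + s ^ 2) ≤ 3 * n * (n * 0.7 + s ^ 2) :=
    mul_le_mul hK (by linarith) hQ (by linarith)
  have h3 : 3 * n * s ^ 2 ≤ n * n * s ^ 2 := by gcongr
  have h4 : n ^ 2 * 0.83 ≤ n ^ 2 * s := by gcongr
  have h5 : 0 ≤ n ^ 2 := sq_nonneg n
  linarith

/-- From `n < K / 3` one gets `|K - 2h| ≤ K / √3`, so `h ≥ 0.21 K`; as `K ≥ 10`, also `h ≥ 3`. Both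
bounds then follow from `ε² > h`. -/
theorem radius_bounds_of_hamming {K n h : ℕ} {ε : ℝ} (hε : 0 < ε) (hn : 3 ≤ n)
    (hK : 3 * n < K) (hh : ((K : ℝ) - 2 * h) ^ 2 ≤ n * K) (hhε : (h : ℝ) < ε ^ 2) :
    1.7 ≤ ε ∧ Real.sqrt K ≤ 2.19 * ε := by
  have hn' : (3 : ℝ) ≤ n := by exact_mod_cast hn
  have hK' : 3 * (n : ℝ) + 1 ≤ K := by exact_mod_cast hK
  have hK10 : (10 : ℝ) ≤ K := by linarith
  have hKK : 3 * ((K : ℝ) - 2 * h) ^ 2 ≤ K ^ 2 := by nlinarith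
  have hh3 : (3 : ℝ) ≤ h := by
    by_contra hlt
    have h1 : h < 3 := by exact_mod_cast not_le.1 hlt
    have h2 : (h : ℝ) ≤ 2 := by exact_mod_cast (by omega : h ≤ 2)
    have h3 : ((K : ℝ) - 4) ^ 2 ≤ (K - 2 * h) ^ 2 := by
      gcongr
      · linarith
      · linarith
    nlinarith
  have hhK : 0.21 * (K : ℝ) ≤ h := by
    by_contra hlt
    rw [not_le] at hlt
    have h1 : (0.58 * (K : ℝ)) ^ 2 ≤ (K - 2 * h) ^ 2 := by
      gcongr
      linarith
    nlinarith
  refine ⟨by nlinarith, Real.sqrt_le_iff.2 ⟨by positivity, by nlinarith⟩⟩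

theorem norm_label_sub_lt_of_sampleDist_lt {a b : Sample d r L k K} {ε : ℝ} (hε : 0 < ε)
    (h : sampleDist d r L k K a b < ENNReal.ofReal ε) :
    ‖a.label.vec - b.label.vec‖ < ε := by
  have h1 : edist a.label.vec b.label.vec < ENNReal.ofReal ε := le_add_self.trans_lt h
  rwa [edist_dist, ENNReal.ofReal_lt_ofReal_iff hε, dist_eq_norm] at h1

theorem exists_label_near_of_cover {n : ℕ} {ε : ℝ} (hε : 0 < ε) (a : Sample d r L k K)
    (c : Fin n → Sample d r L k K)
    (hc : ∀ a, ∃ i, sampleDist d r L k K (c i) a < ENNReal.ofReal ε) (y : Label K) :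
    ∃ i, ‖(c i).label.vec - y.vec‖ < ε := by
  obtain ⟨i, hi⟩ := hc ⟨a.input, y⟩
  have h := norm_label_sub_lt_of_sampleDist_lt hε hi
  exact ⟨i, h⟩

theorem label_eq_of_norm_sub_lt_one {y z : Label K} (h : ‖y.vec - z.vec‖ < 1) : y = z := by
  have h1 : ‖y.vec - z.vec‖ ^ 2 < 1 := by
    nlinarith [norm_nonneg (y.vec - z.vec)]
  rw [Label.norm_sub_sq] at h1
  have h2 : (Finset.univ.filter fun k => y.vec k ≠ z.vec k).card = 0 := by
    exact_mod_cast Nat.lt_one_iff.1 (by exact_mod_cast h1)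
  rw [Finset.card_eq_zero, Finset.filter_eq_empty_iff] at h2
  exact Subtype.ext (PiLp.ext fun k => not_not.1 (h2 (Finset.mem_univ k)))

/-- If two balls of radius at most one cover the space, then they may be centered at the same
input. -/
theorem exists_cover_same_input {ε : ℝ} (hε : 0 < ε) (hε1 : ε ≤ 1) (hK : 1 ≤ K)
    (c : Fin 2 → Sample d r L k K)
    (hc : ∀ a, ∃ i, sampleDist d r L k K (c i) a < ENNReal.ofReal ε) :
    ∃ c' : Fin 2 → Sample d r L k K,
      (∀ a, ∃ i, sampleDist d r L k K (c' i) a < ENNReal.ofReal ε) ∧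
        ∀ i j, (c' i).input = (c' j).input := by
  have hlab : ∀ a i, sampleDist d r L k K (c i) a < ENNReal.ofReal ε → (c i).label = a.label :=
    fun a i h => label_eq_of_norm_sub_lt_one
      ((norm_label_sub_lt_of_sampleDist_lt hε h).trans_le hε1)
  have hsurj : ∀ y : Label K, ∃ i, (c i).label = y := fun y => by
    obtain ⟨i, hi⟩ := hc ⟨(c 0).input, y⟩
    exact ⟨i, hlab _ _ hi⟩
  have hne : (c 0).label ≠ (c 1).label := by
    intro h
    have hall : ∀ y : Label K, y = (c 0).label := fun y => by
      obtain ⟨i, rfl⟩ := hsurj y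
      fin_cases i
      · rfl
      · exact h.symm
    have h1 := (hall (Label.indicator ∅)).trans (hall (Label.indicator Finset.univ)).symm
    have h2 := congrArg (fun y : Label K => y.vec ⟨0, hK⟩) h1
    simp [Label.vec, Label.indicator] at h2
  -- A ball of radius at most one contains a single label, so the points labelled like the first
  -- center all lie in its ball.
  have hinput : ∀ x, inputDist d r L k (c 0).input x < ENNReal.ofReal ε := fun x => by
    obtain ⟨i, hi⟩ := hc ⟨x, (c 0).label⟩
    have h1 := hlab _ _ hi
    fin_cases i
    · exact le_self_add.trans_lt hi
    · exact absurd h1.symm hne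
  refine ⟨fun i => ⟨(c 0).input, (c i).label⟩, fun a => ?_, fun i j => rfl⟩
  obtain ⟨i, hi⟩ := hsurj a.label
  refine ⟨i, ?_⟩
  rw [sampleDist, hi, edist_self, add_zero]
  exact hinput _

/-- With probability at least `1 - p` over `N` samples, the generalization error of all hypotheses
of the Lipschitz class is at most `R`. -/
def HasUniformBound (k : InputKind) (m : ℕ) (CΘ BΘ : ℝ) (loss : Vec m → Label K → ℝ)
    (τ : Measure (Sample d r L k K)) (N : ℕ) (p R : ℝ) : Prop :=
  ∃ U : Set (Fin N → Sample d r L k K), MeasurableSet U ∧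
    ENNReal.ofReal (1 - p) ≤ Measure.pi (fun _ : Fin N => τ) U ∧
    ∀ X ∈ U, ∀ M ∈ LipClass (inputDist d r L k) m CΘ BΘ,
      |risk loss τ M - empiricalRisk loss X M| ≤ R

theorem hasUniformBound_of_oscillation (hC : 0 ≤ Closs) (hloss : LossLipschitz Closs loss)
    (τ : Measure (Sample d r L k K)) [IsProbabilityMeasure τ] {N : ℕ} (hN : 1 ≤ N) {p R : ℝ}
    (hp : 0 < p) (hR : ∀ M ∈ LipClass (inputDist d r L k) m CΘ BΘ, ∀ a b : Sample d r L k K,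
      |loss (M a.input) a.label - loss (M b.input) b.label| ≤ R) :
    HasUniformBound k m CΘ BΘ loss τ N p R := by
  refine ⟨Set.univ, MeasurableSet.univ, ?_, fun X _ M hM =>
    abs_risk_sub_empiricalRisk_le hC hloss hM τ hN (hR M hM) X⟩
  rw [measure_univ]
  exact ENNReal.ofReal_le_one.2 (by linarith)

theorem HasUniformBound.mono {τ : Measure (Sample d r L k K)} {N : ℕ} {p R R' : ℝ}
    (h : HasUniformBound k m CΘ BΘ loss τ N p R) (hR : R ≤ R') :
    HasUniformBound k m CΘ BΘ loss τ N p R' := by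
  obtain ⟨U, hU, hUp, hUX⟩ := h
  exact ⟨U, hU, hUp, fun X hX M hM => (hUX X hX M hM).trans hR⟩

/-- The oscillation over the centers splits into an output part `α BΘ` and a label part `β`. Each of
`α t` and `β t` is compared separately with `u`, which gives the factor `BΘ + 1`. -/
theorem hasUniformBound_of_cover (hC : 0 ≤ Closs) (hloss : LossLipschitz Closs loss)
    (hBΘ : 0 ≤ BΘ) (τ : Measure (Sample d r L k K)) [IsProbabilityMeasure τ] {N : ℕ}
    (hN : 1 ≤ N) {p : ℝ} (hp : 0 < p) (hp1 : p < 1) {n : ℕ} (hn : 2 ≤ n) {ε : ℝ} (hε : 0 < ε)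
    (hξ : (n : ℝ) ^ 2 * Real.log n / ε ^ 2 ≤ N) (c : Fin n → Sample d r L k K)
    (hc : ∀ a, ∃ i, sampleDist d r L k K (c i) a < ENNReal.ofReal ε) {α β : ℝ} (hα : 0 ≤ α)
    (hβ : 0 ≤ β) (hw : ∀ M ∈ LipClass (inputDist d r L k) m CΘ BΘ, ∀ i j,
      loss (M (c i).input) (c i).label - loss (M (c j).input) (c j).label ≤ Closs * (α * BΘ + β))
    (hα' : α ^ 2 * (((n : ℝ) - 1) * Real.log 2 + Real.log (2 / p)) ≤
      n ^ 2 * Real.log n * (1 + Real.sqrt (Real.log (2 / p))) ^ 2)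
    (hβ' : β ^ 2 * (((n : ℝ) - 1) * Real.log 2 + Real.log (2 / p)) ≤
      n ^ 2 * Real.log n * (1 + Real.sqrt (Real.log (2 / p))) ^ 2) :
    HasUniformBound k m CΘ BΘ loss τ N p (2 * (Closs * max CΘ 1 * ε) +
      ε * (1 + Real.sqrt (Real.log (2 / p))) / Real.sqrt 2 * (Closs * (BΘ + 1))) := by
  have hN0 : (0 : ℝ) < N := by exact_mod_cast hN
  have hn1 : (2 : ℝ) ≤ n := by exact_mod_cast hn
  have hl : 0 < Real.log 2 := Real.log_pos one_lt_two
  have hℓ : 0 ≤ Real.log (2 / p) := Real.log_nonneg ((le_div_iff₀ hp).2 (by linarith))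
  have hQ : 0 ≤ ((n : ℝ) - 1) * Real.log 2 + Real.log (2 / p) :=
    add_nonneg (mul_nonneg (by linarith) hl.le) hℓ
  set t := Real.sqrt ((((n : ℝ) - 1) * Real.log 2 + Real.log (2 / p)) / (2 * N)) with ht
  have ht2 : 2 * N * t ^ 2 = ((n : ℝ) - 1) * Real.log 2 + Real.log (2 / p) := by
    rw [ht, Real.sq_sqrt (by positivity)]
    field_simp
  have hαt := mul_sqrt_div_le hα hε hN0 hξ hα' hQ
  have hβt := mul_sqrt_div_le hβ hε hN0 hξ hβ' hQ
  set u := ε * (1 + Real.sqrt (Real.log (2 / p))) / Real.sqrt 2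
  refine HasUniformBound.mono (exists_event_of_cover hε c hc hC hloss τ hN hp
    (Real.sqrt_nonneg _) ht2.ge hw) (add_le_add le_rfl ?_)
  calc Closs * (α * BΘ + β) * t = Closs * (α * t * BΘ + β * t) := by ring
    _ ≤ Closs * (u * BΘ + u) := by gcongr
    _ = u * (Closs * (BΘ + 1)) := by ring

theorem hasUniformBound_at_scale (hr : 0 < r) (hK : 1 ≤ K) (hC : 0 ≤ Closs)
    (hloss : LossLipschitz Closs loss) (hBΘ : 0 ≤ BΘ)
    (τ : Measure (Sample d r L k K)) [IsProbabilityMeasure τ] {N : ℕ} (hN : 1 ≤ N) {p : ℝ}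
    (hp : 0 < p) (hp1 : p < 1) {ε : ℝ} (hε : 0 < ε) (hξ : xi (sampleDist d r L k K) ε ≤ N) :
    HasUniformBound k m CΘ BΘ loss τ N p (2 * (Closs * max CΘ 1 * ε) +
      ε * (1 + Real.sqrt (Real.log (2 / p))) / Real.sqrt 2 * (Closs * (BΘ + 1))) := by
  have hcov : CoveredBy (sampleDist d r L k K) ε (coveringNumber (sampleDist d r L k K) ε) :=
    Nat.sInf_mem (exists_coveredBy_sampleDist d hr L k K hε)
  rw [xi] at hξ
  generalize coveringNumber (sampleDist d r L k K) ε = n at hcov hξ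
  obtain ⟨c, hc⟩ := hcov
  have hℓ2 : Real.log 2 ≤ Real.log (2 / p) :=
    Real.log_le_log two_pos ((le_div_iff₀ hp).2 (by linarith))
  have hl2 := Real.log_two_gt_d9
  have hs2 : Real.sqrt (Real.log (2 / p)) ^ 2 = Real.log (2 / p) := Real.sq_sqrt (by linarith)
  -- From `p < 1`, since `√(log 2) > 0.83`.
  have hs1 : 0.83 ≤ Real.sqrt (Real.log (2 / p)) :=
    Real.le_sqrt_of_sq_le (by norm_num; linarith)
  have hq2 : Real.sqrt 2 ≤ 1.4143 := Real.sqrt_le_iff.2 ⟨by norm_num, by norm_num⟩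
  have hq2' : 0 < Real.sqrt 2 := Real.sqrt_pos.2 two_pos
  have hsK2 : Real.sqrt K ^ 2 = K := Real.sq_sqrt (Nat.cast_nonneg K)
  have hcover := fun hn => hasUniformBound_of_cover (m := m) (CΘ := CΘ) hC hloss hBΘ τ hN hp hp1
    (n := n) hn hε hξ
  obtain ⟨a₀⟩ : Nonempty (Sample d r L k K) := by
    by_contra h
    rw [not_nonempty_iff] at h
    exact IsProbabilityMeasure.ne_zero τ (Subsingleton.elim _ _)
  have hcl := exists_label_near_of_cover hε a₀ c hc
  have hosc : ∀ M ∈ LipClass (inputDist d r L k) m CΘ BΘ, ∀ a b : Sample d r L k K,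
      |loss (M a.input) a.label - loss (M b.input) b.label| ≤
        Closs * (2 * BΘ + Real.sqrt K) := fun M hM a b => abs_loss_sub_le hC hloss hM a b
  have hosc' : ∀ M ∈ LipClass (inputDist d r L k) m CΘ BΘ, ∀ i j,
      loss (M (c i).input) (c i).label - loss (M (c j).input) (c j).label ≤
        Closs * (2 * BΘ + Real.sqrt K) := fun M hM i j =>
    (le_abs_self _).trans (hosc M hM _ _)
  generalize hs : Real.sqrt (Real.log (2 / p)) = s at hs2 hs1 hcover
  rw [← hs2] at hcover
  generalize hu : ε * (1 + s) / Real.sqrt 2 = u at hcover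
  have hu' : u * Real.sqrt 2 = ε * (1 + s) := by
    rw [← hu]
    field_simp
  have hu0 : 0 < u := by
    rw [← hu]
    positivity
  have hu1 : 1.29 * ε ≤ u := by
    rw [← hu, le_div_iff₀ hq2']
    calc 1.29 * ε * Real.sqrt 2 ≤ 1.29 * ε * 1.4143 := by gcongr
      _ ≤ ε * (1 + 0.83) := by linarith
      _ ≤ ε * (1 + s) := by gcongr
  -- The sample-independent case: `u ≥ 2` pays for the outputs, while the term `2Cε` and the `1` in
  -- `BΘ + 1` pay for the labels.
  have det : 2 ≤ u → Real.sqrt K ≤ 2 * ε + u → HasUniformBound k m CΘ BΘ loss τ N p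
      (2 * (Closs * max CΘ 1 * ε) + u * (Closs * (BΘ + 1))) := by
    intro hu2 hKε
    refine (hasUniformBound_of_oscillation hC hloss τ hN hp hosc).mono ?_
    have h1 : Closs * (2 * BΘ + Real.sqrt K) ≤ Closs * (u * BΘ + (2 * ε + u)) := by gcongr
    have h2 : Closs * ε ≤ Closs * max CΘ 1 * ε := by
      gcongr
      exact le_mul_of_one_le_right hC (le_max_right _ _)
    linarith
  obtain rfl | rfl | rfl | hn3 : n = 0 ∨ n = 1 ∨ n = 2 ∨ 3 ≤ n := by omega
  · exact (hc a₀).choose.elim0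
  -- A single ball: every value of the loss is near its value at the center, and no probability is
  -- involved.
  · refine (hasUniformBound_of_oscillation (R := 2 * (Closs * max CΘ 1 * ε)) hC hloss τ hN hp
      fun M hM a b => ?_).mono ?_
    · have h0 : ∀ a : Sample d r L k K,
          |loss (M (c 0).input) (c 0).label - loss (M a.input) a.label| ≤
            Closs * max CΘ 1 * ε := fun a => by
        obtain ⟨i, hi⟩ := hc a
        rw [Subsingleton.elim i 0] at hi
        exact abs_loss_sub_le_of_sampleDist_lt hC hloss hM hε hi
      have ha := abs_le.1 (h0 a)
      have hb := abs_le.1 (h0 b)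
      rw [abs_le]
      constructor <;> linarith [ha.1, ha.2, hb.1, hb.2]
    · have : 0 ≤ u * (Closs * (BΘ + 1)) := by positivity
      linarith
  · have hhalf := half_lt_sq_of_cover_two (fun i => (c i).label) hcl
    have hKhalf : (K : ℝ) ≤ 2 * ((K / 2 : ℕ) : ℝ) + 1 := by
      exact_mod_cast (by omega : K ≤ 2 * (K / 2) + 1)
    push_cast at hcover
    rcases le_or_gt ε 1 with hε1 | hε1
    · have hK1 : K = 1 := by
        have : ((K / 2 : ℕ) : ℝ) < 1 := hhalf.trans_le (pow_le_one₀ hε.le hε1)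
        have : K / 2 < 1 := by exact_mod_cast this
        omega
      -- With a common input the outputs at the centers coincide, so `α = 0`. This avoids `α = 2`,
      -- which is not admissible for two balls when `p` is small.
      obtain ⟨c', hc', hin⟩ := exists_cover_same_input hε hε1 hK c hc
      refine hcover trivial c' hc' (α := 0) (β := 1) le_rfl zero_le_one (fun M hM i j => ?_) ?_
        (one_mul_log_two_add_sq_le (by linarith))
      · refine (le_abs_self _).trans ((hloss _ _ _ _).trans ?_)
        refine mul_le_mul_of_nonneg_left (add_le_add ?_ ?_) hC
        · simp [hin i j]
        · exact (Label.norm_sub_le _ _).trans (by simp [hK1])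
      · rw [zero_pow two_ne_zero, zero_mul]
        positivity
    · rcases le_or_gt 2 u with hu2 | hu2
      · refine det hu2 (Real.sqrt_le_iff.2 ⟨by linarith, ?_⟩)
        have h1 : (2 * ε + 2) ^ 2 ≤ (2 * ε + u) ^ 2 := by gcongr
        linarith [sq_nonneg ε]
      -- If `u < 2` and `ε > 1`, then `s` and `ε` are both bounded; two balls then allow only `K ≤
      -- 5`, within reach of the concentration bound.
      · have hεs : ε * (1 + s) < 2.8286 := by
          rw [← hu']
          calc u * Real.sqrt 2 < 2 * Real.sqrt 2 := by gcongr
            _ ≤ 2.8286 := by linarith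
        have hs3 : s ≤ 1.8286 := by
          have : 1 * (1 + s) ≤ ε * (1 + s) := by gcongr
          linarith
        have hε3 : ε ≤ 1.546 := by
          have : ε * 1.83 ≤ ε * (1 + s) := by
            gcongr
            linarith
          linarith
        have hK5 : (K : ℝ) ≤ 5 := by
          have h1 : ε ^ 2 ≤ 1.546 ^ 2 := by gcongr
          have h2 : ((K / 2 : ℕ) : ℝ) < 3 := hhalf.trans_le (h1.trans (by norm_num))
          have : K / 2 < 3 := by exact_mod_cast h2
          exact_mod_cast (by omega : K ≤ 5)
        refine hcover trivial c hc (α := 2) (β := Real.sqrt K) zero_le_two (Real.sqrt_nonneg _)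
          hosc' (four_mul_log_two_add_sq_le hs1 hs3) ?_
        rw [hsK2]
        refine le_trans ?_ (five_mul_log_two_add_sq_le hs1 hs3)
        gcongr
  · have hn3' : (3 : ℝ) ≤ n := by exact_mod_cast hn3
    rcases le_or_gt K (3 * n) with hKn | hKn
    · refine hcover (by omega) c hc (α := 2) (β := Real.sqrt K) zero_le_two (Real.sqrt_nonneg _)
        hosc' (four_mul_card_log_two_add_sq_le hn3' hs1) ?_
      rw [hsK2]
      exact dim_mul_card_log_two_add_sq_le hn3' hs1 (by exact_mod_cast hKn)
    -- More than `3n` coordinates covered by `n` balls: `ε` is so large that `u ≥ 1.29 ε > 2` and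
    -- `√K ≤ 2ε + u`.
    · obtain ⟨h, hh, hhε⟩ := exists_hamming_of_cover (fun i => (c i).label) hcl
      obtain ⟨h1, h2⟩ := radius_bounds_of_hamming hε hn3 hKn hh hhε
      exact det (by linarith) (by linarith)

end Scale

/-! ### The generalization bound -/

section Generalization

variable {d L K m : ℕ} {r : ℝ} {k : InputKind} {loss : Vec m → Label K → ℝ} {Closs CΘ BΘ : ℝ}

/-- The infimum defining `ξ⁻¹(N)` need not be attained. The event is the limsup of the given ones:
its probability is the limit of those of the decreasing tails, and a sample in it satisfies bounds
`R j` with arbitrarily large `j`. -/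
theorem HasUniformBound.of_tendsto {τ : Measure (Sample d r L k K)} [IsProbabilityMeasure τ]
    {N : ℕ} {p R₀ : ℝ} {R : ℕ → ℝ} (hR : Tendsto R atTop (𝓝 R₀))
    (h : ∀ n, HasUniformBound k m CΘ BΘ loss τ N p (R n)) :
    HasUniformBound k m CΘ BΘ loss τ N p R₀ := by
  choose U hU hUp hUX using h
  set V : ℕ → Set (Fin N → Sample d r L k K) := fun n => ⋃ j ≥ n, U j
  have hV : ∀ n, MeasurableSet (V n) := fun n =>
    MeasurableSet.iUnion fun j => MeasurableSet.iUnion fun _ => hU j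
  have hanti : Antitone V := fun a b hab =>
    Set.biUnion_mono (fun j hj => le_trans hab hj) fun _ _ => le_rfl
  refine ⟨⋂ n, V n, MeasurableSet.iInter hV, ?_, fun X hX M hM => ?_⟩
  · refine ge_of_tendsto' (tendsto_measure_iInter_atTop (fun n => (hV n).nullMeasurableSet) hanti
      ⟨0, measure_ne_top _ _⟩) fun n => (hUp n).trans (measure_mono ?_)
    exact Set.subset_biUnion_of_mem (u := U) (le_refl n)
  · by_contra hlt
    rw [not_le] at hlt
    obtain ⟨n, hn⟩ := eventually_atTop.1 (hR.eventually_lt_const hlt)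
    obtain ⟨j, hj, hXj⟩ := Set.mem_iUnion₂.1 (Set.mem_iInter.1 hX n)
    exact absurd (hUX j X hXj M hM) (not_le.2 (hn j hj))

/-- Makes the set defining `xiInv` nonempty. At `ε = 1 + κ(1)³` monotonicity gives `κ(ε)² log κ(ε) ≤
κ(1)³ ≤ ε²`. -/
theorem exists_xi_le (hr : 0 < r) {N : ℕ} (hN : 1 ≤ N) :
    ∃ ε : ℝ, 0 < ε ∧ xi (sampleDist d r L k K) ε ≤ N := by
  set κ := coveringNumber (sampleDist d r L k K)
  have hκ : κ (1 + κ 1 ^ 3) ≤ κ 1 := by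
    obtain ⟨c, hc⟩ : CoveredBy (sampleDist d r L k K) 1 (κ 1) :=
      Nat.sInf_mem (exists_coveredBy_sampleDist d hr L k K one_pos)
    refine Nat.sInf_le ⟨c, fun x => ?_⟩
    obtain ⟨i, hi⟩ := hc x
    refine ⟨i, hi.trans_le (ENNReal.ofReal_le_ofReal ?_)⟩
    exact le_add_of_nonneg_right (by positivity)
  refine ⟨1 + κ 1 ^ 3, by positivity, ?_⟩
  have hN' : (1 : ℝ) ≤ N := by exact_mod_cast hN
  rw [xi, div_le_iff₀ (by positivity)]
  have hκ' : (κ (1 + κ 1 ^ 3) : ℝ) ≤ κ 1 := by exact_mod_cast hκ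
  have hlog : Real.log (κ (1 + κ 1 ^ 3)) ≤ κ 1 :=
    (Real.log_le_self (Nat.cast_nonneg _)).trans hκ'
  have h1 : (κ (1 + κ 1 ^ 3) : ℝ) ^ 2 * Real.log (κ (1 + κ 1 ^ 3)) ≤ (κ 1 : ℝ) ^ 2 * κ 1 :=
    mul_le_mul (by gcongr) hlog (Real.log_natCast_nonneg _) (by positivity)
  have h2 : (0 : ℝ) ≤ (κ 1 : ℝ) ^ 3 := by positivity
  calc (κ (1 + κ 1 ^ 3) : ℝ) ^ 2 * Real.log (κ (1 + κ 1 ^ 3)) ≤ (κ 1 : ℝ) ^ 3 := by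
        linarith [pow_succ (κ 1 : ℝ) 2]
    _ ≤ 1 * (1 + (κ 1 : ℝ) ^ 3) ^ 2 := by nlinarith
    _ ≤ N * (1 + (κ 1 : ℝ) ^ 3) ^ 2 := by gcongr

theorem hasUniformBound_xiInv (hr : 0 < r) (hK : 1 ≤ K) (hC : 0 ≤ Closs)
    (hloss : LossLipschitz Closs loss) (hBΘ : 0 ≤ BΘ) {B : ℝ} (hB : Closs * (BΘ + 1) ≤ B)
    (τ : Measure (Sample d r L k K)) [IsProbabilityMeasure τ] {N : ℕ} (hN : 1 ≤ N) {p : ℝ}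
    (hp : 0 < p) :
    HasUniformBound k m CΘ BΘ loss τ N p (xiInv (sampleDist d r L k K) N *
      (2 * (Closs * max CΘ 1) +
        1 / Real.sqrt 2 * B * (1 + Real.sqrt (Real.log (2 / p))))) := by
  rcases le_or_gt 1 p with hp1 | hp1
  -- For `p ≥ 1` the required probability is nonpositive, so the empty event serves.
  · refine ⟨∅, MeasurableSet.empty, ?_, fun X hX => absurd hX (Set.notMem_empty X)⟩
    rw [ENNReal.ofReal_of_nonpos (by linarith)]
    exact zero_le
  obtain ⟨ε, -, hlim, hε⟩ := exists_seq_tendsto_sInf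
    (S := {ε : ℝ | 0 < ε ∧ xi (sampleDist d r L k K) ε ≤ N}) (exists_xi_le hr hN)
    ⟨0, fun ε hε => hε.1.le⟩
  have hx0 : 0 ≤ xiInv (sampleDist d r L k K) N := Real.sInf_nonneg fun ε hε => hε.1.le
  refine HasUniformBound.mono (HasUniformBound.of_tendsto (R₀ := 2 * (Closs * max CΘ 1 *
    xiInv (sampleDist d r L k K) N) + xiInv (sampleDist d r L k K) N *
      (1 + Real.sqrt (Real.log (2 / p))) / Real.sqrt 2 * (Closs * (BΘ + 1))) ?_ fun n =>
    hasUniformBound_at_scale hr hK hC hloss hBΘ τ hN hp hp1 (hε n).1 (hε n).2) ?_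
  · exact ((hlim.const_mul _).const_mul _).add
      (((hlim.mul_const _).div_const _).mul_const _)
  · have h : xiInv (sampleDist d r L k K) N * (1 + Real.sqrt (Real.log (2 / p))) / Real.sqrt 2 *
        (Closs * (BΘ + 1)) ≤ xiInv (sampleDist d r L k K) N *
          (1 + Real.sqrt (Real.log (2 / p))) / Real.sqrt 2 * B := by gcongr
    refine (add_le_add_right h _).trans (le_of_eq ?_)
    ring

end Generalization

end MPNNGen

end

theorem mainTheorem7 (r : ℝ) (hr : 0 < r) (L : ℕ) :
    -- the class of Lipschitz functions contains the MPNNs, for suitable constants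
    (∀ A₁ A₂ : ℝ, 0 < A₁ → 0 < A₂ →
      ∃ CΘ BΘ : ℝ, 0 < CΘ ∧ 0 < BΘ ∧
        ∀ (d m : ℕ) (k : MPNNGen.InputKind) (Φ : MPNNGen.MPNN d L m), Φ.MemTheta A₁ A₂ →
          Φ.output r k ∈ MPNNGen.LipClass (MPNNGen.inputDist d r L k) m CΘ BΘ) ∧
    -- the covering numbers are finite and the generalization bound holds
    (∀ (d K m : ℕ) (k : MPNNGen.InputKind), 1 ≤ K →
      (∀ ε : ℝ, 0 < ε → ∃ n : ℕ, MPNNGen.CoveredBy (MPNNGen.sampleDist d r L k K) ε n) ∧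
      ∀ (loss : MPNNGen.Vec m → MPNNGen.Label K → ℝ) (Closs : ℝ), 0 ≤ Closs →
        MPNNGen.LossLipschitz Closs loss →
      ∀ (CΘ BΘ : ℝ), 0 < CΘ → 0 < BΘ →
      ∀ (C B : ℝ), C = Closs * max CΘ 1 →
        B = Closs * (BΘ + 1) + |loss 0 (MPNNGen.Label.zero K)| →
      ∀ (τ : MeasureTheory.Measure (MPNNGen.Sample d r L k K)),
        MeasureTheory.IsProbabilityMeasure τ →
      ∀ (N : ℕ), 1 ≤ N → ∀ (p : ℝ), 0 < p →
        ∃ U : Set (Fin N → MPNNGen.Sample d r L k K),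
          MeasurableSet U ∧
          ENNReal.ofReal (1 - p) ≤ MeasureTheory.Measure.pi (fun _ : Fin N => τ) U ∧
          ∀ X ∈ U, ∀ M ∈ MPNNGen.LipClass (MPNNGen.inputDist d r L k) m CΘ BΘ,
            |MPNNGen.risk loss τ M - MPNNGen.empiricalRisk loss X M| ≤
              MPNNGen.xiInv (MPNNGen.sampleDist d r L k K) N *
                (2 * C + 1 / Real.sqrt 2 * B * (1 + Real.sqrt (Real.log (2 / p))))) := by
  refine ⟨fun A₁ A₂ h₁ h₂ => ?_, fun d K m k hK =>
    ⟨fun ε hε => MPNNGen.exists_coveredBy_sampleDist d hr L k K hε, ?_⟩⟩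
  · have hb := MPNNGen.featureBound_pos hr h₁ h₂ L
    have hl := MPNNGen.featureLip_pos hr h₁ h₂ L
    exact ⟨A₁ * (MPNNGen.featureLip r A₁ A₂ L + MPNNGen.featureBound r A₁ A₂ L),
      A₁ * MPNNGen.featureBound r A₁ A₂ L + A₂, by positivity, by positivity,
      fun d m k Φ hΦ => MPNNGen.MPNN.output_mem_lipClass hr h₁ h₂ hΦ k⟩
  · intro loss Closs hCloss hloss CΘ BΘ _ hBΘ C B hC hB τ hτ N hN p hp
    subst hC
    exact MPNNGen.hasUniformBound_xiInv hr hK hCloss hloss hBΘ.le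
      (by rw [hB]; exact le_add_of_nonneg_right (abs_nonneg _)) τ hN hp
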